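/- Let $U=\begin{pmatrix}a&b\\c&d\end{pmatrix}$ be a unitary $2\times2$ complex matrix with $abcd\neq0$, and put $J=\operatorname{diag}\!\left(1,\,-\frac{\overline a\,d}{|a|^2}\right)$. Consider the quantum walk on $\mathbb Z$ with states $\Psi_t=\sum_{x\in\mathbb Z}|x\rangle\otimes|\psi_t(x)\rangle$, $\psi_t(x)\in\mathbb C^2=\operatorname{span}\{|0\rangle,|1\rangle\}$, with initial state $\Psi_0=|0\rangle\otimes(\alpha|0\rangle+\beta|1\rangle)$, where $\alpha,\beta\in\mathbb C$ and $|\alpha|^2+|\beta|^2=1$, and with evolution $$\Psi_{t+1}=\tilde S\tilde U\Psi_t\quad(t\equiv0,1 \bmod 3),\qquad \Psi_{t+1}=\tilde S\tilde J\Psi_t\quad(t\equiv2\bmod 3),$$ where $\tilde U=\sum_x|x\rangle\langle x|\otimes U$, $\tilde J=\sum_x|x\rangle\langle x|\otimes J$ and $\tilde S=\sum_x\bigl(|x-1\rangle\langle x|\otimes|0\rangle\langle0|+|x+1\rangle\langle x|\otimes|1\rangle\langle1|\bigr)$. Let $X_t$ be the position at time $t$, so that $\mathbb P(X_t=x)=\|\psi_t(x)\|^2$.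 Define $$D(x)=1+8|a|^2-9|a|^2x^2,$$ $$W_+(x)=-(1-4|a|^2)+3(1-2|a|^2)x^2+2|b|x\sqrt{D(x)},$$ $$W_-(x)=1+8|a|^2-3(1+2|a|^2)x^2-2|b|x\sqrt{D(x)},$$ $$f(x)=\frac{|b|\left(|b|x+\sqrt{D(x)}\right)^2}{\pi(1-x^2)\sqrt{W_+(x)}\sqrt{W_-(x)}\sqrt{D(x)}},$$ $$\begin{aligned}\chi(\alpha,\beta;x)={}&\frac{9|a|^4(|\alpha|^2-|\beta|^2)+3(1+6|a|^2)\operatorname{Re}(a\alpha\overline{b\beta})}{|a|^2(1+8|a|^2)}\,x\\&+\frac{|ab|^2(|\alpha|^2-|\beta|^2)-(1+2|a|^2)\operatorname{Re}(a\alpha\overline{b\beta})}{|a^2b|(1+8|a|^2)}\sqrt{D(x)},\end{aligned}$$ and, with $\ell=\frac{1-4|a|^2}{3}$, $r=\frac{\sqrt{1+8|a|^2}}{3}$ and $I_A$ the indicator function of $A$, $$\rho(y)=\{1-\chi(\alpha,\beta;y)\}f(y)I_{(\ell,r)}(y)+\{1+\chi(\alpha,\beta;-y)\}f(-y)I_{(-r,-\ell)}(y).$$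 Then $\rho$ is a probability density on $\mathbb R$ (it is nonnegative almost everywhere and integrable, with integral $1$), and $X_{3t}/(3t)$ converges in distribution as $t\to\infty$ to the law with density $\rho$: for every $x\in\mathbb R$, $$\lim_{t\to\infty}\mathbb P\left(\frac{X_{3t}}{3t}\le x\right)=\int_{-\infty}^x\rho(y)\,dy.$$ -/

import Mathlib

open MeasureTheory Filter Topology
open scoped Matrix ComplexConjugate

noncomputable section

namespace ThreePeriodWalk

/-- A state of the walker: `Ψ x` is the coin vector (in the basis `|0⟩, |1⟩`) at position `x`.
All states reached from a localized state have finite support. -/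
abbrev State : Type := ℤ → Fin 2 → ℂ

/-- The initial state `|0⟩ ⊗ (α|0⟩ + β|1⟩)`. -/
def initialState (α β : ℂ) : State := fun x => if x = 0 then ![α, β] else 0

/-- The coin-flip operator `∑ₓ |x⟩⟨x| ⊗ M`. -/
def coin (M : Matrix (Fin 2) (Fin 2) ℂ) (Ψ : State) : State := fun x => M *ᵥ Ψ x

/-- The position shift `∑ₓ |x-1⟩⟨x| ⊗ |0⟩⟨0| + |x+1⟩⟨x| ⊗ |1⟩⟨1|`. -/
def shift (Ψ : State) : State := fun x => ![Ψ (x + 1) 0, Ψ (x - 1) 1]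

/-- The coin `U = a|0⟩⟨0| + b|0⟩⟨1| + c|1⟩⟨0| + d|1⟩⟨1|`. -/
def coinU (a b c d : ℂ) : Matrix (Fin 2) (Fin 2) ℂ := !![a, b; c, d]

/-- The coin `J = |0⟩⟨0| - (conj a * d / |a|²)|1⟩⟨1|`. -/
def coinJ (a d : ℂ) : Matrix (Fin 2) (Fin 2) ℂ :=
  !![1, 0; 0, -(conj a * d / ((‖a‖ ^ 2 : ℝ) : ℂ))]

/-- The state at time `t` of the 3-period time-dependent walk: the step from time `t` to `t + 1`
uses `U` if `t ≡ 0, 1 (mod 3)`, and `J` if `t ≡ 2 (mod 3)`. -/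
def walk (a b c d α β : ℂ) : ℕ → State
  | 0 => initialState α β
  | t + 1 =>
    if t % 3 = 2 then shift (coin (coinJ a d) (walk a b c d α β t))
    else shift (coin (coinU a b c d) (walk a b c d α β t))

/-- The probability of finding a walker in state `Ψ` at position `x`. -/
def positionProb (Ψ : State) (x : ℤ) : ℝ := ‖Ψ x 0‖ ^ 2 + ‖Ψ x 1‖ ^ 2

/-- The law of the position `X_t` of the walker at time `t`. -/
def positionLaw (a b c d α β : ℂ) (t : ℕ) : Measure ℤ :=
  Measure.sum fun x : ℤ =>
    ENNReal.ofReal (positionProb (walk a b c d α β t) x) • Measure.dirac x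

lemma hasSum_positionProb_shift {Ψ : State} {r : ℝ} (h : HasSum (positionProb Ψ) r) :
    HasSum (positionProb (shift Ψ)) r := by
  have h0 : Summable fun x => ‖Ψ x 0‖ ^ 2 :=
    h.summable.of_nonneg_of_le (fun _ => by positivity)
      (fun x => le_add_of_nonneg_right (by positivity))
  have h1 : Summable fun x => ‖Ψ x 1‖ ^ 2 :=
    h.summable.of_nonneg_of_le (fun _ => by positivity)
      (fun x => le_add_of_nonneg_left (by positivity))
  have e : r = ∑' x, ‖Ψ x 0‖ ^ 2 + ∑' x, ‖Ψ x 1‖ ^ 2 := by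
    rw [← h.tsum_eq]; exact h0.tsum_add h1
  rw [e]
  have g0 := (Equiv.addRight (1 : ℤ)).hasSum_iff.mpr h0.hasSum
  have g1 := (Equiv.subRight (1 : ℤ)).hasSum_iff.mpr h1.hasSum
  exact g0.add g1

lemma positionProb_coin {M : Matrix (Fin 2) (Fin 2) ℂ}
    (hM : M ∈ Matrix.unitaryGroup (Fin 2) ℂ) (Ψ : State) :
    positionProb (coin M Ψ) = positionProb Ψ := by
  funext x
  have key : ∀ v : Fin 2 → ℂ, ((‖v 0‖ ^ 2 + ‖v 1‖ ^ 2 : ℝ) : ℂ) = star v ⬝ᵥ v := by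
    intro v
    simp [dotProduct, Fin.sum_univ_two, Complex.conj_mul']
  have h := Matrix.mem_unitaryGroup_iff'.mp hM
  have : ((positionProb (coin M Ψ) x : ℝ) : ℂ) = (positionProb Ψ x : ℝ) := by
    unfold positionProb
    rw [key, key]
    simp only [coin]
    rw [Matrix.star_mulVec, Matrix.dotProduct_mulVec, Matrix.vecMul_vecMul,
      ← Matrix.star_eq_conjTranspose, h, Matrix.vecMul_one]
  exact_mod_cast this

lemma coinJ_mem {a b c d : ℂ} (hU : coinU a b c d ∈ Matrix.unitaryGroup (Fin 2) ℂ)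
    (ha : a ≠ 0) : coinJ a d ∈ Matrix.unitaryGroup (Fin 2) ℂ := by
  have h1 := Matrix.mem_unitaryGroup_iff'.mp hU
  have h2 := Matrix.mem_unitaryGroup_iff.mp hU
  have e1 := congrFun (congrFun h1 0) 0
  have e2 := congrFun (congrFun h2 1) 1
  simp [coinU, Matrix.mul_apply, Fin.sum_univ_two, Matrix.star_apply, Complex.conj_mul',
    Complex.mul_conj'] at e1 e2
  have e : (‖a‖ : ℂ) ^ 2 = (‖d‖ : ℂ) ^ 2 := by linear_combination e1 - e2
  have ha' : (‖a‖ : ℂ) ≠ 0 := by simpa using ha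
  rw [Matrix.mem_unitaryGroup_iff']
  ext i j
  fin_cases i <;> fin_cases j <;>
    simp [coinJ, Matrix.mul_apply, Fin.sum_univ_two, Matrix.star_apply]
  have q1 := Complex.mul_conj' a
  have q2 := Complex.conj_mul' d
  field_simp
  linear_combination (conj d * d) * q1 + (‖a‖ : ℂ) ^ 2 * q2 - (‖a‖ : ℂ) ^ 2 * e

/-- The probabilities `ℙ(X_t = x)` sum to one. -/
theorem hasSum_positionProb_walk {a b c d α β : ℂ}
    (hU : coinU a b c d ∈ Matrix.unitaryGroup (Fin 2) ℂ) (ha : a ≠ 0)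
    (h : ‖α‖ ^ 2 + ‖β‖ ^ 2 = 1) (t : ℕ) :
    HasSum (positionProb (walk a b c d α β t)) 1 := by
  induction t with
  | zero =>
    have h0 := hasSum_single (f := positionProb (walk a b c d α β 0)) (0 : ℤ)
      (by intro x hx; simp [positionProb, walk, initialState, hx])
    have e : positionProb (walk a b c d α β 0) 0 = 1 := by
      simpa [positionProb, walk, initialState] using h
    rwa [e] at h0
  | succ t ih =>
    rw [walk]
    split_ifs
    · apply hasSum_positionProb_shift
      rwa [positionProb_coin (coinJ_mem hU ha)]
    · apply hasSum_positionProb_shift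
      rwa [positionProb_coin hU]

/-- `X_t` has a probability law. -/
theorem isProbabilityMeasure_positionLaw {a b c d α β : ℂ}
    (hU : coinU a b c d ∈ Matrix.unitaryGroup (Fin 2) ℂ) (ha : a ≠ 0)
    (h : ‖α‖ ^ 2 + ‖β‖ ^ 2 = 1) (t : ℕ) :
    IsProbabilityMeasure (positionLaw a b c d α β t) := by
  have hs := hasSum_positionProb_walk hU ha h t
  refine ⟨?_⟩
  rw [positionLaw, Measure.sum_apply _ MeasurableSet.univ]
  simp only [Measure.smul_apply, measure_univ, smul_eq_mul, mul_one]
  rw [← ENNReal.ofReal_tsum_of_nonneg (fun x => by unfold positionProb; positivity) hs.summable,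
    hs.tsum_eq, ENNReal.ofReal_one]

/-- `D(x) = 1 + 8|a|² - 9|a|²x²`. -/
def D (a : ℂ) (x : ℝ) : ℝ := 1 + 8 * ‖a‖ ^ 2 - 9 * ‖a‖ ^ 2 * x ^ 2

/-- `W₊(x) = -(1 - 4|a|²) + 3(1 - 2|a|²)x² + 2|b|x√D(x)`. -/
def Wplus (a b : ℂ) (x : ℝ) : ℝ :=
  -(1 - 4 * ‖a‖ ^ 2) + 3 * (1 - 2 * ‖a‖ ^ 2) * x ^ 2 + 2 * ‖b‖ * x * √(D a x)

/-- `W₋(x) = 1 + 8|a|² - 3(1 + 2|a|²)x² - 2|b|x√D(x)`. -/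
def Wminus (a b : ℂ) (x : ℝ) : ℝ :=
  1 + 8 * ‖a‖ ^ 2 - 3 * (1 + 2 * ‖a‖ ^ 2) * x ^ 2 - 2 * ‖b‖ * x * √(D a x)

/-- The function `f`. -/
def f (a b : ℂ) (x : ℝ) : ℝ :=
  ‖b‖ * (‖b‖ * x + √(D a x)) ^ 2 /
    (Real.pi * (1 - x ^ 2) * √(Wplus a b x) * √(Wminus a b x) * √(D a x))

/-- The initial-state term `χ(α, β; x)`. -/
def χ (a b α β : ℂ) (x : ℝ) : ℝ :=
  1 / (‖a‖ ^ 2 * (1 + 8 * ‖a‖ ^ 2)) *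
      (9 * ‖a‖ ^ 4 * (‖α‖ ^ 2 - ‖β‖ ^ 2)
        + 3 * (1 + 6 * ‖a‖ ^ 2) * (a * α * conj (b * β)).re) * x
    + 1 / (‖a ^ 2 * b‖ * (1 + 8 * ‖a‖ ^ 2)) *
      (‖a * b‖ ^ 2 * (‖α‖ ^ 2 - ‖β‖ ^ 2)
        - (1 + 2 * ‖a‖ ^ 2) * (a * α * conj (b * β)).re) * √(D a x)

/-- The inner end point `(1 - 4|a|²)/3` (possibly negative). -/
def innerEnd (a : ℂ) : ℝ := (1 - 4 * ‖a‖ ^ 2) / 3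

/-- The outer end point `√(1 + 8|a|²)/3`. -/
def outerEnd (a : ℂ) : ℝ := √(1 + 8 * ‖a‖ ^ 2) / 3

/-- The limit density. The two intervals overlap if `|a| > 1/2`. -/
def limitDensity (a b α β : ℂ) (y : ℝ) : ℝ :=
  (1 - χ a b α β y) * f a b y * (Set.Ioo (innerEnd a) (outerEnd a)).indicator 1 y
    + (1 + χ a b α β (-y)) * f a b (-y)
      * (Set.Ioo (-outerEnd a) (-innerEnd a)).indicator 1 y

end ThreePeriodWalk

end

/-!
The walk is translation invariant over each period of three steps, so it is diagonalized by the
Fourier transform. Put `p = |a|²` and `u = 4p cos² κ`. After a translation of the wave number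
(`fourier`, with twist `η² = a / d`), one period acts on the coin space at wave number `κ` as a
constant phase times the unitary matrix `sin κ (u - 1) + i cos κ N(κ)` (`stepMatrix`,
`three_step_symbol`), where `N` is Hermitian and `N² = Q` is the scalar `(u - 2p - 1)² + 4p(1 - p)
> 0`. Its eigenvalues `e_± = sin κ (u - 1) ± i cos κ √Q` and its spectral projections are
therefore smooth in `κ`, and `e_±' = ± 3 i v e_±` with the velocity `v = (1 + 8p - 3u) / (3 √Q)`.

By Parseval (`integral_star_fourier_dotProduct`), the characteristic function of `X_{3t} / (3t)`
at `ξ` is the mean over `κ` of the inner product of the evolved coin states at `κ` and `κ - ξ /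
(3t)`. With the initial coin state `φ = (α, β)` and the spectral projections `P_±` it converges
pointwise to `∑_± ‖P_± φ‖² exp (∓ i ξ v)` (`tendsto_star_dotProduct`): on one branch the quotient
of phases is of the form `(1 + z / t + o(1 / t))^t`, and two different branches are orthogonal in
the limit. Dominated convergence gives the limit of the characteristic functions.

The symmetries `κ ↦ κ + π` and `κ ↦ -κ` reduce the limit to an integral over `(0, π / 2)`
(`integral_fold`), on which `v` increases from the inner to the outer end point. At `y = v(κ)` the
radical `√D(y)` equals `|b| (1 + 8p - u) / √Q` (`sqrt_D_velocity`), from which `f(v(κ)) v'(κ) = 1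
/ π` (`velocityDeriv_mul_f`), while `χ(v(κ))` is the difference of the weights of the two
branches, symmetrized in `κ` (`bandExpectation_add_neg`). So the change of variables `y = v(κ)`
identifies the limit as the characteristic function of the measure with density `limitDensity`.
Lévy's convergence theorem yields weak convergence, and the limit has no atoms, so the
distribution functions converge at every point.
-/

noncomputable section

namespace ThreePeriodWalk

/-! ### The velocity and the change of variables -/

/-- The variable `u = 4p cos² κ`, where `p = |a|²`. The spectrum of the three-step evolution and the
velocity depend on the wave number `κ` only through `u` and the signs of `sin κ` and `cos κ`. -/
def bandArg (p κ : ℝ) : ℝ := 4 * p * Real.cos κ ^ 2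

/-- The square of `gap p κ`, written as a sum of squares: it never vanishes for `0 < p < 1`. -/
def gapSq (p κ : ℝ) : ℝ := (bandArg p κ - 2 * p - 1) ^ 2 + 4 * p * (1 - p)

/-- The positive eigenvalue of `bandMatrix`. The eigenvalues of the three-step evolution are, up to
a constant phase, `sin κ (u - 1) ± i cos κ * gap`; dividing out the factor `cos κ` makes the two
eigenvalues and their eigenvectors smooth in `κ`, also at `κ = ±π/2`, where the eigenvalues
coincide. -/
def gap (p κ : ℝ) : ℝ := √(gapSq p κ)

/-- One third of the derivative of the phase of the eigenvalue `bandPhase p 1 κ`. Per time step, the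
branch with eigenvalue `bandPhase p 1` moves with velocity `-velocity p κ` and the other branch with
velocity `velocity p κ`. -/
def velocity (p κ : ℝ) : ℝ := (1 + 8 * p - 3 * bandArg p κ) / (3 * gap p κ)

section
variable {p : ℝ}

lemma gapSq_pos (h0 : 0 < p) (h1 : p < 1) (κ : ℝ) : 0 < gapSq p κ := by
  have : 0 < 4 * p * (1 - p) := by have := sub_pos.2 h1; positivity
  unfold gapSq; positivity

lemma gap_pos (h0 : 0 < p) (h1 : p < 1) (κ : ℝ) : 0 < gap p κ :=
  Real.sqrt_pos.2 (gapSq_pos h0 h1 κ)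

lemma gap_sq (h0 : 0 < p) (h1 : p < 1) (κ : ℝ) : gap p κ ^ 2 = gapSq p κ :=
  Real.sq_sqrt (gapSq_pos h0 h1 κ).le

lemma bandArg_le (h0 : 0 < p) (κ : ℝ) : bandArg p κ ≤ 4 * p := by
  unfold bandArg
  nlinarith [Real.cos_sq_le_one κ]

lemma hasDerivAt_bandArg (p κ : ℝ) :
    HasDerivAt (bandArg p) (-(8 * p * Real.cos κ * Real.sin κ)) κ := by
  have := ((Real.hasDerivAt_cos κ).pow 2).const_mul (4 * p)
  refine this.congr_deriv ?_
  simp only [Nat.cast_ofNat, Nat.add_one_sub_one, pow_one]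
  ring

lemma hasDerivAt_gap (h0 : 0 < p) (h1 : p < 1) (κ : ℝ) :
    HasDerivAt (gap p)
      (-(8 * p * Real.cos κ * Real.sin κ) * (bandArg p κ - 2 * p - 1) / gap p κ) κ := by
  have hu := hasDerivAt_bandArg p κ
  have hQ : HasDerivAt (gapSq p) (2 * (bandArg p κ - 2 * p - 1) *
      (-(8 * p * Real.cos κ * Real.sin κ))) κ := by
    have := (((hu.sub_const (2 * p)).sub_const 1).pow 2).add_const (4 * p * (1 - p))
    refine this.congr_deriv ?_
    simp
  refine (hQ.sqrt (gapSq_pos h0 h1 κ).ne').congr_deriv ?_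
  have := (gap_pos h0 h1 κ).ne'
  unfold gap at this ⊢
  field_simp

/-- The derivative of `velocity p`. -/
def velocityDeriv (p κ : ℝ) : ℝ :=
  16 * p * (1 - p) * Real.cos κ * Real.sin κ * (1 + 8 * p - bandArg p κ) / (3 * gap p κ ^ 3)

lemma hasDerivAt_velocity (h0 : 0 < p) (h1 : p < 1) (κ : ℝ) :
    HasDerivAt (velocity p) (velocityDeriv p κ) κ := by
  have hS := gap_pos h0 h1 κ
  have hd := (((hasDerivAt_bandArg p κ).const_mul 3).const_sub (1 + 8 * p)).div
    ((hasDerivAt_gap h0 h1 κ).const_mul 3) (by positivity)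
  refine hd.congr_deriv ?_
  have hsq := gap_sq h0 h1 κ
  unfold gapSq at hsq
  unfold velocityDeriv
  field_simp
  ring_nf at hsq ⊢
  linear_combination (24 * Real.cos κ * Real.sin κ) * hsq

lemma continuous_bandArg (p : ℝ) : Continuous (bandArg p) := by unfold bandArg; fun_prop

lemma continuous_gap (p : ℝ) : Continuous (gap p) := by
  have := continuous_bandArg p
  unfold gap gapSq; fun_prop

lemma continuous_velocity (h0 : 0 < p) (h1 : p < 1) : Continuous (velocity p) :=
  continuous_iff_continuousAt.2 fun κ => (hasDerivAt_velocity h0 h1 κ).continuousAt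

lemma velocityDeriv_pos (h0 : 0 < p) (h1 : p < 1) {κ : ℝ} (hκ : κ ∈ Set.Ioo 0 (Real.pi / 2)) :
    0 < velocityDeriv p κ := by
  have hc : 0 < Real.cos κ := Real.cos_pos_of_mem_Ioo ⟨by linarith [hκ.1, Real.pi_pos], hκ.2⟩
  have hs : 0 < Real.sin κ := Real.sin_pos_of_pos_of_lt_pi hκ.1 (by linarith [hκ.2, Real.pi_pos])
  have hS := gap_pos h0 h1 κ
  have := bandArg_le h0 κ
  have h2 : 0 < 1 + 8 * p - bandArg p κ := by linarith
  have h3 := sub_pos.2 h1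
  unfold velocityDeriv
  positivity

lemma gap_zero : gap p 0 = 1 := by
  simp only [gap, gapSq, bandArg, Real.cos_zero]
  rw [show (4 * p * 1 ^ 2 - 2 * p - 1) ^ 2 + 4 * p * (1 - p) = 1 by ring, Real.sqrt_one]

lemma gap_pi_div_two : gap p (Real.pi / 2) = √(1 + 8 * p) := by
  simp only [gap, gapSq, bandArg, Real.cos_pi_div_two]
  congr 1; ring

lemma velocity_zero (a : ℂ) : velocity (‖a‖ ^ 2) 0 = innerEnd a := by
  simp only [velocity, gap_zero, innerEnd, bandArg, Real.cos_zero]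
  ring

lemma velocity_pi_div_two (a : ℂ) : velocity (‖a‖ ^ 2) (Real.pi / 2) = outerEnd a := by
  have h : 0 < √(1 + 8 * ‖a‖ ^ 2) := Real.sqrt_pos.2 (by positivity)
  have h2 : √(1 + 8 * ‖a‖ ^ 2) ^ 2 = 1 + 8 * ‖a‖ ^ 2 := Real.sq_sqrt (by positivity)
  simp only [velocity, gap_pi_div_two, outerEnd, bandArg, Real.cos_pi_div_two]
  field_simp
  rw [h2]; ring

end

lemma one_sub_velocity_sq {p : ℝ} (h0 : 0 < p) (h1 : p < 1) (κ : ℝ) : 1 - velocity p κ ^ 2 =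
    4 * (1 - p) * (2 * (1 + 8 * p) - 3 * bandArg p κ) / (9 * gap p κ ^ 2) := by
  have hS := gap_pos h0 h1 κ
  have hsq := gap_sq h0 h1 κ
  unfold gapSq at hsq
  unfold velocity
  field_simp
  rw [hsq]; ring

section
variable {a b : ℂ}

/-- In the variable `κ` the square root `√D` becomes rational in `u` and the gap, because `D` is
then a perfect square. Through this identity the nested radicals in `f` disappear. -/
lemma sqrt_D_velocity (h0 : 0 < ‖a‖ ^ 2) (h1 : ‖a‖ ^ 2 < 1) (hab : ‖a‖ ^ 2 + ‖b‖ ^ 2 = 1)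
    (κ : ℝ) : √(D a (velocity (‖a‖ ^ 2) κ)) =
      ‖b‖ * (1 + 8 * ‖a‖ ^ 2 - bandArg (‖a‖ ^ 2) κ) / gap (‖a‖ ^ 2) κ := by
  have hS := gap_pos h0 h1 κ
  have hsq := gap_sq h0 h1 κ
  have hu := bandArg_le h0 κ
  have hq : ‖b‖ ^ 2 = 1 - ‖a‖ ^ 2 := by linarith
  have hn : 0 ≤ 1 + 8 * ‖a‖ ^ 2 - bandArg (‖a‖ ^ 2) κ := by linarith
  rw [← Real.sqrt_sq (show 0 ≤ ‖b‖ * (1 + 8 * ‖a‖ ^ 2 - bandArg (‖a‖ ^ 2) κ) / gap (‖a‖ ^ 2) κ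
    by positivity)]
  congr 1
  unfold D velocity
  rw [div_pow, div_pow, mul_pow, mul_pow, hq, hsq]
  have hQ := (gapSq_pos h0 h1 κ).ne'
  field_simp
  unfold gapSq
  ring

lemma Wminus_velocity (h0 : 0 < ‖a‖ ^ 2) (h1 : ‖a‖ ^ 2 < 1) (hab : ‖a‖ ^ 2 + ‖b‖ ^ 2 = 1)
    (κ : ℝ) : Wminus a b (velocity (‖a‖ ^ 2) κ) =
      3 * bandArg (‖a‖ ^ 2) κ * (1 - velocity (‖a‖ ^ 2) κ ^ 2) := by
  have hS := gap_pos h0 h1 κ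
  have hsq := gap_sq h0 h1 κ
  have hq : ‖b‖ ^ 2 = 1 - ‖a‖ ^ 2 := by linarith
  unfold Wminus
  rw [sqrt_D_velocity h0 h1 hab]
  unfold velocity
  field_simp
  rw [hsq, hq]
  unfold gapSq
  ring

lemma Wplus_velocity (h0 : 0 < ‖a‖ ^ 2) (h1 : ‖a‖ ^ 2 < 1) (hab : ‖a‖ ^ 2 + ‖b‖ ^ 2 = 1)
    (κ : ℝ) : Wplus a b (velocity (‖a‖ ^ 2) κ) =
      3 * (4 * ‖a‖ ^ 2 - bandArg (‖a‖ ^ 2) κ) * (1 - velocity (‖a‖ ^ 2) κ ^ 2) := by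
  have h : Wplus a b (velocity (‖a‖ ^ 2) κ) + Wminus a b (velocity (‖a‖ ^ 2) κ) =
      12 * ‖a‖ ^ 2 * (1 - velocity (‖a‖ ^ 2) κ ^ 2) := by
    unfold Wplus Wminus; ring
  rw [Wminus_velocity h0 h1 hab] at h
  linear_combination h

/-- The function `f` is the density, in the velocity variable, of the uniform measure `dκ / π` on
`(0, π / 2)`. -/
lemma velocityDeriv_mul_f (h0 : 0 < ‖a‖ ^ 2) (h1 : ‖a‖ ^ 2 < 1) (hab : ‖a‖ ^ 2 + ‖b‖ ^ 2 = 1)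
    {κ : ℝ} (hκ : κ ∈ Set.Ioo 0 (Real.pi / 2)) :
    velocityDeriv (‖a‖ ^ 2) κ * f a b (velocity (‖a‖ ^ 2) κ) = 1 / Real.pi := by
  have hS := gap_pos h0 h1 κ
  have hsq := gap_sq h0 h1 κ
  have hu := bandArg_le h0 κ
  have hq : ‖b‖ ^ 2 = 1 - ‖a‖ ^ 2 := by linarith
  have hb : 0 < ‖b‖ := by
    rcases (norm_nonneg b).eq_or_lt with h | h
    · rw [← h] at hq; nlinarith
    · exact h
  have hc : 0 < Real.cos κ := Real.cos_pos_of_mem_Ioo ⟨by linarith [hκ.1, Real.pi_pos], hκ.2⟩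
  have hs : 0 < Real.sin κ := Real.sin_pos_of_pos_of_lt_pi hκ.1 (by linarith [hκ.2, Real.pi_pos])
  have hm : 0 < 1 + 8 * ‖a‖ ^ 2 - bandArg (‖a‖ ^ 2) κ := by linarith
  have hy := one_sub_velocity_sq h0 h1 κ
  have hY : 0 < 1 - velocity (‖a‖ ^ 2) κ ^ 2 := by
    rw [hy]
    have : 0 < 2 * (1 + 8 * ‖a‖ ^ 2) - 3 * bandArg (‖a‖ ^ 2) κ := by linarith
    have := sub_pos.2 h1
    positivity
  -- `W₊W₋` is a perfect square because `u (4p - u) = (4p cos κ sin κ)²`.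
  have hWW : √(Wplus a b (velocity (‖a‖ ^ 2) κ)) * √(Wminus a b (velocity (‖a‖ ^ 2) κ)) =
      3 * (1 - velocity (‖a‖ ^ 2) κ ^ 2) * (4 * ‖a‖ ^ 2 * Real.cos κ * Real.sin κ) := by
    rw [Wplus_velocity h0 h1 hab, Wminus_velocity h0 h1 hab, ← Real.sqrt_mul,
      ← Real.sqrt_sq (show 0 ≤ 3 * (1 - velocity (‖a‖ ^ 2) κ ^ 2) *
        (4 * ‖a‖ ^ 2 * Real.cos κ * Real.sin κ) by positivity)]
    · congr 1
      have := Real.sin_sq_add_cos_sq κ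
      have h2 : Real.sin κ ^ 2 = 1 - Real.cos κ ^ 2 := by linarith
      unfold bandArg
      simp only [mul_pow]
      rw [h2]; ring
    · have : 0 ≤ 4 * ‖a‖ ^ 2 - bandArg (‖a‖ ^ 2) κ := by linarith
      positivity
  have hsum : ‖b‖ * velocity (‖a‖ ^ 2) κ + √(D a (velocity (‖a‖ ^ 2) κ)) =
      3 * gap (‖a‖ ^ 2) κ * (1 - velocity (‖a‖ ^ 2) κ ^ 2) / (2 * ‖b‖) := by
    rw [hy, sqrt_D_velocity h0 h1 hab, ← hq]
    unfold velocity
    field_simp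
    ring
  unfold f
  rw [hsum, mul_assoc (Real.pi * _), hWW, sqrt_D_velocity h0 h1 hab]
  set y := velocity (‖a‖ ^ 2) κ
  unfold velocityDeriv
  rw [← hq]
  have := Real.pi_pos
  have ha : ‖a‖ ≠ 0 := fun h => by simp [h] at h0
  have := hc.ne'
  have := hs.ne'
  have := hS.ne'
  have := hY.ne'
  generalize 1 + 8 * ‖a‖ ^ 2 - bandArg (‖a‖ ^ 2) κ = m at hm ⊢
  field_simp
  norm_num

/-- The term `χ`, read at the velocity, is the expectation of `bandMatrix` in the initial state,
divided by the gap and symmetrized in `κ`. -/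
lemma χ_velocity (h0 : 0 < ‖a‖ ^ 2) (h1 : ‖a‖ ^ 2 < 1) (hab : ‖a‖ ^ 2 + ‖b‖ ^ 2 = 1)
    (α β : ℂ) (κ : ℝ) : χ a b α β (velocity (‖a‖ ^ 2) κ) =
      ((2 * ‖a‖ ^ 2 + 1 - bandArg (‖a‖ ^ 2) κ) * (‖α‖ ^ 2 - ‖β‖ ^ 2) -
        4 * Real.cos (2 * κ) * (a * α * conj (b * β)).re) / gap (‖a‖ ^ 2) κ := by
  have hS := gap_pos h0 h1 κ
  have hq : ‖b‖ ^ 2 = 1 - ‖a‖ ^ 2 := by linarith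
  have hb : ‖b‖ ≠ 0 := fun h => by rw [h] at hq; linarith
  have ha : ‖a‖ ≠ 0 := fun h => by simp [h] at h0
  unfold χ
  rw [sqrt_D_velocity h0 h1 hab, norm_mul, norm_mul, norm_pow, Real.cos_two_mul, mul_pow, hq]
  unfold velocity bandArg
  generalize (a * α * conj (b * β)).re = R
  field_simp
  ring

end

/-! ### Spectral decomposition of the three-step evolution -/

/-- For `σ = ±1`, the eigenvalue of `stepMatrix` on the branch `σ`. -/
def bandPhase (p σ κ : ℝ) : ℂ :=
  ((Real.sin κ * (bandArg p κ - 1) : ℝ) : ℂ) + ((σ * (Real.cos κ * gap p κ) : ℝ) : ℂ) * Complex.I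

lemma conj_bandPhase_mul_self {p : ℝ} (h0 : 0 < p) (h1 : p < 1) {σ : ℝ} (hσ : σ ^ 2 = 1) (κ : ℝ) :
    conj (bandPhase p σ κ) * bandPhase p σ κ = 1 := by
  have hsq := gap_sq h0 h1 κ
  have h2 : Real.sin κ ^ 2 = 1 - Real.cos κ ^ 2 := by linarith [Real.sin_sq_add_cos_sq κ]
  have key : (Real.sin κ * (bandArg p κ - 1)) ^ 2 + (σ * (Real.cos κ * gap p κ)) ^ 2 = 1 := by
    rw [mul_pow, mul_pow, mul_pow, hσ, hsq, h2]
    unfold gapSq bandArg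
    ring
  rw [mul_comm, Complex.mul_conj, bandPhase, Complex.normSq_add_mul_I, key, Complex.ofReal_one]

lemma norm_bandPhase {p : ℝ} (h0 : 0 < p) (h1 : p < 1) {σ : ℝ} (hσ : σ ^ 2 = 1) (κ : ℝ) :
    ‖bandPhase p σ κ‖ = 1 := by
  have := conj_bandPhase_mul_self h0 h1 hσ κ
  rw [Complex.conj_mul'] at this
  have h : ‖bandPhase p σ κ‖ ^ 2 = 1 := by exact_mod_cast this
  exact (pow_eq_one_iff_of_nonneg (norm_nonneg _) two_ne_zero).1 h

lemma hasDerivAt_bandPhase {p : ℝ} (h0 : 0 < p) (h1 : p < 1) {σ : ℝ} (hσ : σ ^ 2 = 1) (κ : ℝ) :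
    HasDerivAt (bandPhase p σ)
      (((3 * (σ * velocity p κ) : ℝ) : ℂ) * Complex.I * bandPhase p σ κ) κ := by
  have hS := (gap_pos h0 h1 κ).ne'
  have hsq := gap_sq h0 h1 κ
  have h2 : Real.sin κ ^ 2 = 1 - Real.cos κ ^ 2 := by linarith [Real.sin_sq_add_cos_sq κ]
  have hg : HasDerivAt (fun κ => Real.sin κ * (bandArg p κ - 1))
      (-(3 * velocity p κ * (Real.cos κ * gap p κ))) κ := by
    refine ((Real.hasDerivAt_sin κ).mul ((hasDerivAt_bandArg p κ).sub_const 1)).congr_deriv ?_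
    unfold velocity
    field_simp
    unfold bandArg
    linear_combination (-(8 * p * Real.cos κ)) * h2
  have hs : HasDerivAt (fun κ => σ * (Real.cos κ * gap p κ))
      (3 * (σ * velocity p κ) * (Real.sin κ * (bandArg p κ - 1))) κ := by
    refine (((Real.hasDerivAt_cos κ).mul (hasDerivAt_gap h0 h1 κ)).const_mul σ).congr_deriv ?_
    unfold velocity
    field_simp
    rw [hsq]
    unfold gapSq bandArg
    ring
  refine (hg.ofReal_comp.add (hs.ofReal_comp.mul_const Complex.I)).congr_deriv ?_
  have hσ' : (σ : ℂ) ^ 2 = 1 := by exact_mod_cast hσ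
  unfold bandPhase
  push_cast
  linear_combination (-3 * (velocity p κ : ℂ) * Complex.cos κ * gap p κ * σ ^ 2) * Complex.I_sq +
    (3 * (velocity p κ : ℂ) * Complex.cos κ * gap p κ) * hσ'

/-- The traceless Hermitian matrix `N` of the decomposition `sin κ (u - 1) + i cos κ N` of the
three-step evolution. -/
def bandMatrix (a b : ℂ) (κ : ℝ) : Matrix (Fin 2) (Fin 2) ℂ :=
  !![((2 * ‖a‖ ^ 2 + 1 - bandArg (‖a‖ ^ 2) κ : ℝ) : ℂ),
    -2 * b * conj a * Complex.exp (2 * κ * Complex.I);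
    -2 * conj b * a * Complex.exp (-(2 * κ * Complex.I)),
    -((2 * ‖a‖ ^ 2 + 1 - bandArg (‖a‖ ^ 2) κ : ℝ) : ℂ)]

lemma conjTranspose_bandMatrix (a b : ℂ) (κ : ℝ) : (bandMatrix a b κ)ᴴ = bandMatrix a b κ := by
  have h2 : conj (2 : ℂ) = 2 := map_ofNat _ 2
  ext i j
  fin_cases i <;> fin_cases j <;>
    simp [bandMatrix, Matrix.conjTranspose_apply, ← Complex.exp_conj, mul_assoc, h2]

lemma bandMatrix_mul_self {a b : ℂ} (hab : ‖a‖ ^ 2 + ‖b‖ ^ 2 = 1) (κ : ℝ) :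
    bandMatrix a b κ * bandMatrix a b κ = (gapSq (‖a‖ ^ 2) κ : ℂ) • 1 := by
  have he : Complex.exp (2 * κ * Complex.I) * Complex.exp (-(2 * κ * Complex.I)) = 1 := by
    rw [← Complex.exp_add]; simp
  have hq : (‖b‖ : ℂ) ^ 2 = 1 - (‖a‖ : ℂ) ^ 2 := by
    rw [eq_sub_iff_add_eq']; exact_mod_cast hab
  have ha := Complex.conj_mul' a
  have hb := Complex.conj_mul' b
  have key : (-2 * b * conj a * Complex.exp (2 * κ * Complex.I)) *
      (-2 * conj b * a * Complex.exp (-(2 * κ * Complex.I))) =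
      4 * (‖a‖ : ℂ) ^ 2 * (1 - (‖a‖ : ℂ) ^ 2) := by
    rw [← hq, ← ha, ← hb]
    linear_combination (4 * b * conj a * conj b * a) * he
  ext i j
  fin_cases i <;> fin_cases j <;>
    simp only [bandMatrix, gapSq, Matrix.mul_apply, Fin.sum_univ_two, Matrix.smul_apply,
      Matrix.of_apply, Matrix.cons_val', Matrix.cons_val_zero, Matrix.cons_val_one,
      Matrix.cons_val_fin_one, Fin.zero_eta, Fin.mk_one, Matrix.one_apply_eq, smul_eq_mul,
      Fin.isValue, ne_eq, zero_ne_one, one_ne_zero, not_false_eq_true, Matrix.one_apply_ne] <;>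
    push_cast
  · linear_combination key
  · ring
  · ring
  · linear_combination key

/-- The three-step evolution at wave number `κ`, up to a phase that does not depend on `κ`. -/
def stepMatrix (a b : ℂ) (κ : ℝ) : Matrix (Fin 2) (Fin 2) ℂ :=
  ((Real.sin κ * (bandArg (‖a‖ ^ 2) κ - 1) : ℝ) : ℂ) • (1 : Matrix (Fin 2) (Fin 2) ℂ) +
    (((Real.cos κ : ℝ) : ℂ) * Complex.I) • bandMatrix a b κ

/-- For `σ = ±1`, the component of the coin state `φ` in the eigenspace of `bandMatrix` with
eigenvalue `σ * gap`. -/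
def bandVector (a b : ℂ) (φ : Fin 2 → ℂ) (σ κ : ℝ) : Fin 2 → ℂ :=
  (1 / 2 : ℂ) • (φ + ((σ / gap (‖a‖ ^ 2) κ : ℝ) : ℂ) • (bandMatrix a b κ *ᵥ φ))

section
variable {a b : ℂ}

lemma bandVector_add (φ : Fin 2 → ℂ) (κ : ℝ) :
    bandVector a b φ 1 κ + bandVector a b φ (-1) κ = φ := by
  ext i
  simp only [bandVector, Pi.add_apply, Pi.smul_apply, smul_eq_mul]
  push_cast
  ring

lemma bandMatrix_mulVec_bandVector (h0 : 0 < ‖a‖ ^ 2) (h1 : ‖a‖ ^ 2 < 1)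
    (hab : ‖a‖ ^ 2 + ‖b‖ ^ 2 = 1) (φ : Fin 2 → ℂ) {σ : ℝ} (hσ : σ ^ 2 = 1) (κ : ℝ) :
    bandMatrix a b κ *ᵥ bandVector a b φ σ κ =
      ((σ * gap (‖a‖ ^ 2) κ : ℝ) : ℂ) • bandVector a b φ σ κ := by
  have hS : (gap (‖a‖ ^ 2) κ : ℂ) ≠ 0 := by exact_mod_cast (gap_pos h0 h1 κ).ne'
  have hsq : (gapSq (‖a‖ ^ 2) κ : ℂ) = (gap (‖a‖ ^ 2) κ : ℂ) ^ 2 := by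
    exact_mod_cast (gap_sq h0 h1 κ).symm
  have hσ' : (σ : ℂ) ^ 2 = 1 := by exact_mod_cast hσ
  unfold bandVector
  rw [Matrix.mulVec_smul, Matrix.mulVec_add, Matrix.mulVec_smul, Matrix.mulVec_mulVec,
    bandMatrix_mul_self hab, Matrix.smul_mulVec, Matrix.one_mulVec, hsq]
  ext i
  simp only [Pi.add_apply, Pi.smul_apply, smul_eq_mul]
  push_cast
  field_simp
  linear_combination (-(bandMatrix a b κ *ᵥ φ) i) * hσ'

lemma stepMatrix_mulVec_bandVector (h0 : 0 < ‖a‖ ^ 2) (h1 : ‖a‖ ^ 2 < 1)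
    (hab : ‖a‖ ^ 2 + ‖b‖ ^ 2 = 1) (φ : Fin 2 → ℂ) {σ : ℝ} (hσ : σ ^ 2 = 1) (κ : ℝ) :
    stepMatrix a b κ *ᵥ bandVector a b φ σ κ =
      bandPhase (‖a‖ ^ 2) σ κ • bandVector a b φ σ κ := by
  rw [stepMatrix, Matrix.add_mulVec, Matrix.smul_mulVec, Matrix.smul_mulVec, Matrix.one_mulVec,
    bandMatrix_mulVec_bandVector h0 h1 hab φ hσ, smul_smul, ← add_smul, bandPhase]
  congr 1
  push_cast
  ring

lemma stepMatrix_pow_mulVec (h0 : 0 < ‖a‖ ^ 2) (h1 : ‖a‖ ^ 2 < 1)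
    (hab : ‖a‖ ^ 2 + ‖b‖ ^ 2 = 1) (φ : Fin 2 → ℂ) (κ : ℝ) (t : ℕ) :
    stepMatrix a b κ ^ t *ᵥ φ = bandPhase (‖a‖ ^ 2) 1 κ ^ t • bandVector a b φ 1 κ +
      bandPhase (‖a‖ ^ 2) (-1) κ ^ t • bandVector a b φ (-1) κ := by
  induction t with
  | zero => simp [bandVector_add]
  | succ t ih =>
    rw [pow_succ', ← Matrix.mulVec_mulVec, ih, Matrix.mulVec_add, Matrix.mulVec_smul,
      Matrix.mulVec_smul, stepMatrix_mulVec_bandVector h0 h1 hab φ (by norm_num),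
      stepMatrix_mulVec_bandVector h0 h1 hab φ (by norm_num), smul_smul, smul_smul, ← pow_succ,
      ← pow_succ]

lemma stepMatrix_mem (h0 : 0 < ‖a‖ ^ 2) (h1 : ‖a‖ ^ 2 < 1)
    (hab : ‖a‖ ^ 2 + ‖b‖ ^ 2 = 1) (κ : ℝ) :
    stepMatrix a b κ ∈ Matrix.unitaryGroup (Fin 2) ℂ := by
  have h := conj_bandPhase_mul_self h0 h1 (σ := 1) (by norm_num) κ
  have hsq : (gapSq (‖a‖ ^ 2) κ : ℂ) = (gap (‖a‖ ^ 2) κ : ℂ) ^ 2 := by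
    exact_mod_cast (gap_sq h0 h1 κ).symm
  rw [Matrix.mem_unitaryGroup_iff', Matrix.star_eq_conjTranspose, stepMatrix,
    Matrix.conjTranspose_add, Matrix.conjTranspose_smul, Matrix.conjTranspose_smul,
    conjTranspose_bandMatrix, Matrix.conjTranspose_one]
  simp only [add_mul, mul_add, Matrix.smul_mul, Matrix.mul_smul, bandMatrix_mul_self hab, hsq,
    Matrix.one_mul, Matrix.mul_one, smul_smul]
  simp only [bandPhase, map_add, map_mul, Complex.conj_ofReal, Complex.conj_I] at h
  simp only [star_mul', Complex.star_def, Complex.conj_ofReal, Complex.conj_I]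
  ext i j
  simp only [Matrix.add_apply, Matrix.smul_apply, smul_eq_mul]
  push_cast at h ⊢
  linear_combination ((1 : Matrix (Fin 2) (Fin 2) ℂ) i j) * h

/-- The two spectral components are orthogonal (`σ + τ = 0`, `σ τ = -1`), and their squared norms
(`σ = τ`) are determined by the expectation of `bandMatrix`. -/
lemma star_dotProduct_bandVector (h0 : 0 < ‖a‖ ^ 2) (h1 : ‖a‖ ^ 2 < 1)
    (hab : ‖a‖ ^ 2 + ‖b‖ ^ 2 = 1) (φ : Fin 2 → ℂ) (σ τ κ : ℝ) :
    star (bandVector a b φ σ κ) ⬝ᵥ bandVector a b φ τ κ =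
      ((1 + σ * τ : ℝ) : ℂ) / 4 * (star φ ⬝ᵥ φ) +
      ((σ + τ : ℝ) : ℂ) / 4 * ((star φ ⬝ᵥ bandMatrix a b κ *ᵥ φ) / gap (‖a‖ ^ 2) κ) := by
  have hS : (gap (‖a‖ ^ 2) κ : ℂ) ≠ 0 := by exact_mod_cast (gap_pos h0 h1 κ).ne'
  have hsq : (gapSq (‖a‖ ^ 2) κ : ℂ) = (gap (‖a‖ ^ 2) κ : ℂ) ^ 2 := by
    exact_mod_cast (gap_sq h0 h1 κ).symm
  have e1 : star (bandMatrix a b κ *ᵥ φ) ⬝ᵥ φ = star φ ⬝ᵥ bandMatrix a b κ *ᵥ φ := by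
    rw [Matrix.star_mulVec, conjTranspose_bandMatrix, Matrix.dotProduct_mulVec]
  have e2 : star (bandMatrix a b κ *ᵥ φ) ⬝ᵥ bandMatrix a b κ *ᵥ φ =
      (gap (‖a‖ ^ 2) κ : ℂ) ^ 2 * (star φ ⬝ᵥ φ) := by
    rw [Matrix.star_mulVec, conjTranspose_bandMatrix, Matrix.dotProduct_mulVec,
      Matrix.vecMul_vecMul, bandMatrix_mul_self hab, Matrix.vecMul_smul, Matrix.vecMul_one,
      smul_dotProduct, hsq, smul_eq_mul]
  unfold bandVector
  simp only [star_smul, star_add, smul_dotProduct, dotProduct_smul, add_dotProduct,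
    dotProduct_add, e1, e2, smul_eq_mul, Complex.star_def, Complex.conj_ofReal, map_div₀, map_one,
    map_ofNat]
  push_cast
  field_simp
  ring

/-- The expectation of `bandMatrix` in the coin state `(α, β)`, divided by the gap: the difference
of the weights of the two branches. -/
def bandExpectation (a b α β : ℂ) (κ : ℝ) : ℝ :=
  ((2 * ‖a‖ ^ 2 + 1 - bandArg (‖a‖ ^ 2) κ) * (‖α‖ ^ 2 - ‖β‖ ^ 2) -
    4 * (a * α * conj (b * β) * Complex.exp (-(2 * κ * Complex.I))).re) / gap (‖a‖ ^ 2) κ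

lemma star_dotProduct_bandMatrix (α β : ℂ) (κ : ℝ) :
    (star ![α, β] ⬝ᵥ bandMatrix a b κ *ᵥ ![α, β]) / gap (‖a‖ ^ 2) κ =
      bandExpectation a b α β κ := by
  have hα := Complex.conj_mul' α
  have hβ := Complex.conj_mul' β
  have hre : ∀ z : ℂ, ((z.re : ℝ) : ℂ) = (z + conj z) / 2 := fun z => Complex.re_eq_add_conj z
  have h2 : conj (2 : ℂ) = 2 := map_ofNat _ 2
  unfold bandExpectation
  push_cast
  congr 1
  rw [hre]
  simp [dotProduct, Matrix.mulVec, Fin.sum_univ_two, bandMatrix, ← Complex.exp_conj, h2]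
  linear_combination (2 * (‖a‖ : ℂ) ^ 2 + 1 - bandArg (‖a‖ ^ 2) κ) * (hα - hβ)

end

/-! ### Pointwise limit of the inner products -/

lemma star_dotProduct_self (v : Fin 2 → ℂ) :
    star v ⬝ᵥ v = ((‖v 0‖ ^ 2 + ‖v 1‖ ^ 2 : ℝ) : ℂ) := by
  simp [dotProduct, Fin.sum_univ_two, Complex.conj_mul']

lemma star_dotProduct_mulVec_unitary {M : Matrix (Fin 2) (Fin 2) ℂ}
    (hM : M ∈ Matrix.unitaryGroup (Fin 2) ℂ) (v : Fin 2 → ℂ) :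
    star (M *ᵥ v) ⬝ᵥ M *ᵥ v = star v ⬝ᵥ v := by
  rw [Matrix.star_mulVec, Matrix.dotProduct_mulVec, Matrix.vecMul_vecMul,
    ← Matrix.star_eq_conjTranspose, Matrix.mem_unitaryGroup_iff'.mp hM, Matrix.vecMul_one]

lemma norm_star_dotProduct_le {u v : Fin 2 → ℂ} (hu : star u ⬝ᵥ u = 1) (hv : star v ⬝ᵥ v = 1) :
    ‖star u ⬝ᵥ v‖ ≤ 1 := by
  rw [star_dotProduct_self] at hu hv
  have hu' : ‖u 0‖ ^ 2 + ‖u 1‖ ^ 2 = 1 := by exact_mod_cast hu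
  have hv' : ‖v 0‖ ^ 2 + ‖v 1‖ ^ 2 = 1 := by exact_mod_cast hv
  calc ‖star u ⬝ᵥ v‖ ≤ ‖u 0‖ * ‖v 0‖ + ‖u 1‖ * ‖v 1‖ := by
        simp only [dotProduct, Fin.sum_univ_two]
        refine (norm_add_le _ _).trans ?_
        simp
    _ ≤ 1 := by nlinarith [sq_nonneg (‖u 0‖ - ‖v 0‖), sq_nonneg (‖u 1‖ - ‖v 1‖)]

lemma continuous_bandMatrix (a b : ℂ) : Continuous (bandMatrix a b) := by
  have := continuous_bandArg (‖a‖ ^ 2)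
  refine continuous_matrix fun i j => ?_
  fin_cases i <;> fin_cases j <;> simp [bandMatrix] <;> fun_prop

lemma continuous_stepMatrix (a b : ℂ) : Continuous (stepMatrix a b) := by
  have := continuous_bandArg (‖a‖ ^ 2)
  have := continuous_bandMatrix a b
  unfold stepMatrix
  fun_prop

section
variable {a b : ℂ}

lemma continuous_bandVector (h0 : 0 < ‖a‖ ^ 2) (h1 : ‖a‖ ^ 2 < 1) (φ : Fin 2 → ℂ) (σ : ℝ) :
    Continuous (bandVector a b φ σ) := by
  have h2 : Continuous fun κ => ((σ / gap (‖a‖ ^ 2) κ : ℝ) : ℂ) :=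
    Complex.continuous_ofReal.comp
      (continuous_const.div (continuous_gap _) fun κ => (gap_pos h0 h1 κ).ne')
  have h3 := (continuous_bandMatrix a b).matrix_mulVec (continuous_const (y := φ))
  unfold bandVector
  exact ((h2.smul h3).const_add φ).const_smul (1 / 2 : ℂ)

/-- A phase factor compared with itself at a wave number shifted by `ξ / (3t)`, over `t` periods,
converges to an exponential of its logarithmic derivative, i.e. of the velocity. -/
lemma tendsto_bandPhase_pow {p : ℝ} (h0 : 0 < p) (h1 : p < 1) {σ : ℝ} (hσ : σ ^ 2 = 1)
    (κ ξ : ℝ) : Tendsto (fun t : ℕ => (conj (bandPhase p σ κ) ^ t *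
      bandPhase p σ (κ - ξ / (3 * t)) ^ t)) atTop
      (𝓝 (Complex.exp (-(ξ * (σ * velocity p κ) : ℝ) * Complex.I))) := by
  have hz : ∀ z : ℝ, Tendsto (fun t : ℕ => z / (3 * (t : ℝ))) atTop (𝓝 0) := fun z =>
    tendsto_const_nhds.div_atTop
      (tendsto_natCast_atTop_atTop.const_mul_atTop (by norm_num : (0 : ℝ) < 3))
  set e := bandPhase p σ κ with he
  have hd : HasDerivAt (fun x : ℝ => conj e * bandPhase p σ (κ - ξ / 3 * x))
      (-(ξ * (σ * velocity p κ) : ℝ) * Complex.I) 0 := by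
    have hin : HasDerivAt (fun x : ℝ => κ - ξ / 3 * x) (-(ξ / 3)) 0 := by
      simpa using ((hasDerivAt_id (0 : ℝ)).const_mul (ξ / 3)).const_sub κ
    have hb := hasDerivAt_bandPhase h0 h1 hσ κ
    rw [show κ = κ - ξ / 3 * 0 by ring] at hb
    have := (hb.scomp (0 : ℝ) hin).const_mul (conj e)
    refine this.congr_deriv ?_
    have hn := conj_bandPhase_mul_self h0 h1 hσ κ
    rw [← he] at hn
    simp only [mul_zero, sub_zero, ← he, Complex.real_smul]
    push_cast
    linear_combination (-(ξ * (σ * velocity p κ) : ℂ) * Complex.I) * hn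
  have h := hd.tendsto_slope_zero_right.comp (tendsto_inv_atTop_nhdsGT_zero.comp
    (tendsto_natCast_atTop_atTop (R := ℝ)))
  have key : Tendsto (fun t : ℕ => (t : ℂ) * (conj e * bandPhase p σ (κ - ξ / (3 * t)) - 1)) atTop
      (𝓝 (-(ξ * (σ * velocity p κ) : ℝ) * Complex.I)) := by
    refine h.congr fun t => ?_
    have hn := conj_bandPhase_mul_self h0 h1 hσ κ
    simp only [Function.comp_apply, zero_add, mul_zero, sub_zero, inv_inv, ← he, Complex.real_smul]
    rw [← he] at hn
    have hshift : ξ / 3 * (t : ℝ)⁻¹ = ξ / (3 * t) := by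
      rw [← div_eq_mul_inv, div_div]
    rw [hn, hshift]
    simp
  refine (Complex.tendsto_one_add_pow_exp_of_tendsto key).congr fun t => ?_
  rw [add_sub_cancel, mul_pow]

/-- The integrand of the characteristic function converges pointwise. The contributions that mix the
two branches vanish in the limit since the branches are orthogonal and the phases are bounded, so no
oscillatory integral has to be estimated. -/
lemma tendsto_star_dotProduct (h0 : 0 < ‖a‖ ^ 2) (h1 : ‖a‖ ^ 2 < 1)
    (hab : ‖a‖ ^ 2 + ‖b‖ ^ 2 = 1) {α β : ℂ} (hαβ : ‖α‖ ^ 2 + ‖β‖ ^ 2 = 1) (κ ξ : ℝ) :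
    Tendsto (fun t : ℕ => star (stepMatrix a b κ ^ t *ᵥ ![α, β]) ⬝ᵥ
      (stepMatrix a b (κ - ξ / (3 * t)) ^ t *ᵥ ![α, β])) atTop
      (𝓝 (((1 + bandExpectation a b α β κ : ℝ) : ℂ) / 2 *
            Complex.exp (-(ξ * velocity (‖a‖ ^ 2) κ : ℝ) * Complex.I) +
          ((1 - bandExpectation a b α β κ : ℝ) : ℂ) / 2 *
            Complex.exp ((ξ * velocity (‖a‖ ^ 2) κ : ℝ) * Complex.I))) := by
  set φ : Fin 2 → ℂ := ![α, β] with hφ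
  have hφ1 : star φ ⬝ᵥ φ = 1 := by
    rw [star_dotProduct_self]; simpa [hφ] using congrArg ((↑) : ℝ → ℂ) hαβ
  have hκ : Tendsto (fun t : ℕ => κ - ξ / (3 * (t : ℝ))) atTop (𝓝 κ) := by
    have : Tendsto (fun t : ℕ => ξ / (3 * (t : ℝ))) atTop (𝓝 0) :=
      tendsto_const_nhds.div_atTop
        (tendsto_natCast_atTop_atTop.const_mul_atTop (by norm_num : (0 : ℝ) < 3))
    simpa using this.const_sub κ
  have hin : ∀ σ τ : ℝ, Tendsto (fun t : ℕ => star (bandVector a b φ σ κ) ⬝ᵥ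
      bandVector a b φ τ (κ - ξ / (3 * t))) atTop
      (𝓝 (((1 + σ * τ : ℝ) : ℂ) / 4 + ((σ + τ : ℝ) : ℂ) / 4 * bandExpectation a b α β κ)) := by
    intro σ τ
    have hv := ((continuous_bandVector (b := b) h0 h1 φ τ).tendsto κ).comp hκ
    have hc : Continuous fun w : Fin 2 → ℂ => star (bandVector a b φ σ κ) ⬝ᵥ w := by
      unfold dotProduct; fun_prop
    have := (hc.tendsto _).comp hv
    rwa [star_dotProduct_bandVector h0 h1 hab, hφ1, mul_one, star_dotProduct_bandMatrix] at this
  have hcross : ∀ σ τ : ℝ, σ ^ 2 = 1 → τ ^ 2 = 1 → σ + τ = 0 →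
      Tendsto (fun t : ℕ => (conj (bandPhase (‖a‖ ^ 2) σ κ) ^ t *
        bandPhase (‖a‖ ^ 2) τ (κ - ξ / (3 * t)) ^ t) *
        (star (bandVector a b φ σ κ) ⬝ᵥ bandVector a b φ τ (κ - ξ / (3 * t)))) atTop (𝓝 0) := by
    intro σ τ hσ hτ hστ
    have h := hin σ τ
    rw [hστ, show (1 + σ * τ : ℝ) = 0 by rw [eq_neg_of_add_eq_zero_right hστ]; linarith] at h
    simp only [Complex.ofReal_zero, zero_div, zero_mul, add_zero] at h
    refine squeeze_zero_norm (fun t => ?_) (by simpa using h.norm)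
    rw [norm_mul, norm_mul, norm_pow, norm_pow, RCLike.norm_conj, norm_bandPhase h0 h1 hσ,
      norm_bandPhase h0 h1 hτ]
    simp
  have hdiag : ∀ σ : ℝ, σ ^ 2 = 1 →
      Tendsto (fun t : ℕ => (conj (bandPhase (‖a‖ ^ 2) σ κ) ^ t *
        bandPhase (‖a‖ ^ 2) σ (κ - ξ / (3 * t)) ^ t) *
        (star (bandVector a b φ σ κ) ⬝ᵥ bandVector a b φ σ (κ - ξ / (3 * t)))) atTop
        (𝓝 (Complex.exp (-(ξ * (σ * velocity (‖a‖ ^ 2) κ) : ℝ) * Complex.I) *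
          (((1 + σ * σ : ℝ) : ℂ) / 4 + ((σ + σ : ℝ) : ℂ) / 4 * bandExpectation a b α β κ))) :=
    fun σ hσ => (tendsto_bandPhase_pow h0 h1 hσ κ ξ).mul (hin σ σ)
  have hall := ((hdiag 1 (by norm_num)).add (hdiag (-1) (by norm_num))).add
    ((hcross 1 (-1) (by norm_num) (by norm_num) (by norm_num)).add
      (hcross (-1) 1 (by norm_num) (by norm_num) (by norm_num)))
  convert hall.congr fun t => ?_ using 2
  rotate_left
  · rw [stepMatrix_pow_mulVec h0 h1 hab, stepMatrix_pow_mulVec h0 h1 hab]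
    simp only [star_smul, star_add, smul_dotProduct, dotProduct_smul, add_dotProduct,
      dotProduct_add, smul_eq_mul, star_pow, Complex.star_def]
    ring
  · push_cast
    ring_nf

end

/-! ### Fourier transform of states -/

lemma hasFiniteSupport_coin {Ψ : State} (h : Function.HasFiniteSupport Ψ)
    (M : Matrix (Fin 2) (Fin 2) ℂ) : Function.HasFiniteSupport (coin M Ψ) :=
  Set.Finite.subset h fun x hx hΨ => hx (by simp [coin, hΨ])

lemma hasFiniteSupport_shift {Ψ : State} (h : Function.HasFiniteSupport Ψ) :
    Function.HasFiniteSupport (shift Ψ) := by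
  refine Set.Finite.subset ((h.preimage (add_left_injective (1 : ℤ)).injOn).union
    (h.preimage (sub_left_injective (b := (1 : ℤ))).injOn)) fun x hx => ?_
  by_contra hc
  rw [Set.mem_union, not_or] at hc
  have e1 : Ψ (x + 1) = 0 := by simpa using hc.1
  have e2 : Ψ (x - 1) = 0 := by simpa using hc.2
  exact hx (by ext i; fin_cases i <;> simp [shift, e1, e2])

lemma hasFiniteSupport_walk (a b c d α β : ℂ) (t : ℕ) :
    Function.HasFiniteSupport (walk a b c d α β t) := by
  induction t with
  | zero =>
    refine Set.Finite.subset (Set.finite_singleton (0 : ℤ)) fun x hx => ?_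
    by_contra h
    exact hx (by simp [walk, initialState, show x ≠ 0 from h])
  | succ t ih =>
    rw [walk]
    split_ifs
    · exact hasFiniteSupport_shift (hasFiniteSupport_coin ih _)
    · exact hasFiniteSupport_shift (hasFiniteSupport_coin ih _)

/-- The Fourier transform of a state, twisted by the factor `η ^ x`. For `|η| = 1` the twist only
translates the wave number; it serves to remove the arguments of `a` and `d` from the three-step
evolution. -/
def fourier (η : ℂ) (Ψ : State) (κ : ℝ) : Fin 2 → ℂ := fun i =>
  ∑' x : ℤ, Complex.exp (-(κ * x * Complex.I)) * η ^ x * Ψ x i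

lemma summable_fourier {Ψ : State} (h : Function.HasFiniteSupport Ψ) (η : ℂ) (κ : ℝ) (i : Fin 2) :
    Summable fun x : ℤ => Complex.exp (-(κ * x * Complex.I)) * η ^ x * Ψ x i :=
  summable_of_hasFiniteSupport (Set.Finite.subset h fun x hx hΨ => hx (by simp [hΨ]))

lemma fourier_coin {Ψ : State} (h : Function.HasFiniteSupport Ψ) (η : ℂ)
    (M : Matrix (Fin 2) (Fin 2) ℂ) (κ : ℝ) :
    fourier η (coin M Ψ) κ = M *ᵥ fourier η Ψ κ := by
  ext i
  simp only [fourier, coin, Matrix.mulVec, dotProduct, Fin.sum_univ_two]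
  rw [← tsum_mul_left, ← tsum_mul_left, ← Summable.tsum_add
    ((summable_fourier h η κ 0).mul_left _) ((summable_fourier h η κ 1).mul_left _)]
  exact tsum_congr fun x => by ring

/-- The action of `shift` on the twisted Fourier transform. -/
def shiftMatrix (η : ℂ) (κ : ℝ) : Matrix (Fin 2) (Fin 2) ℂ :=
  !![Complex.exp (κ * Complex.I) * η⁻¹, 0; 0, Complex.exp (-(κ * Complex.I)) * η]

lemma fourier_shift {η : ℂ} (hη : η ≠ 0) (Ψ : State) (κ : ℝ) :
    fourier η (shift Ψ) κ = shiftMatrix η κ *ᵥ fourier η Ψ κ := by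
  ext i
  fin_cases i
  · simp only [fourier, shiftMatrix, Matrix.mulVec, dotProduct, Fin.sum_univ_two]
    simp only [shift, Fin.zero_eta, Fin.isValue, Matrix.cons_val_zero, Matrix.of_apply,
      Matrix.cons_val', Matrix.cons_val_fin_one, Matrix.cons_val_one, zero_mul, add_zero]
    rw [← tsum_mul_left]
    refine Eq.trans ?_ ((Equiv.addRight (1 : ℤ)).tsum_eq _)
    refine tsum_congr fun x => ?_
    simp only [Equiv.coe_addRight, zpow_add₀ hη, zpow_one]
    rw [show -((κ : ℂ) * ((x + 1 : ℤ) : ℂ) * Complex.I) =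
      -(κ * x * Complex.I) - κ * Complex.I by push_cast; ring, Complex.exp_sub]
    field_simp
  · simp only [fourier, shiftMatrix, Matrix.mulVec, dotProduct, Fin.sum_univ_two]
    simp only [shift, Fin.mk_one, Fin.isValue, Matrix.cons_val_zero, Matrix.of_apply,
      Matrix.cons_val', Matrix.cons_val_fin_one, Matrix.cons_val_one, zero_mul, zero_add]
    rw [← tsum_mul_left]
    refine Eq.trans ?_ ((Equiv.subRight (1 : ℤ)).tsum_eq _)
    refine tsum_congr fun x => ?_
    simp only [Equiv.subRight_apply, zpow_sub₀ hη, zpow_one]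
    rw [show -((κ : ℂ) * ((x - 1 : ℤ) : ℂ) * Complex.I) =
      -(κ * x * Complex.I) + κ * Complex.I by push_cast; ring, Complex.exp_add,
      Complex.exp_neg (κ * _)]
    field_simp

lemma integral_exp_int (n : ℤ) :
    ∫ κ in (-Real.pi)..Real.pi, Complex.exp (κ * n * Complex.I) =
      if n = 0 then 2 * (Real.pi : ℂ) else 0 := by
  split_ifs with h
  · simp [h]; ring
  · have hc : (n : ℂ) * Complex.I ≠ 0 := mul_ne_zero (by exact_mod_cast h) Complex.I_ne_zero
    have := integral_exp_mul_complex (a := -Real.pi) (b := Real.pi) hc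
    rw [show (fun κ : ℝ => Complex.exp (κ * n * Complex.I)) =
      fun κ : ℝ => Complex.exp (n * Complex.I * κ) by ext; ring_nf, this,
      div_eq_zero_iff]
    left
    rw [sub_eq_zero, Complex.exp_eq_exp_iff_exists_int]
    exact ⟨n, by push_cast; ring⟩

/-- Parseval's identity: translating the wave number by `ε` corresponds to weighting the position
probabilities with `exp (i ε x)`. -/
lemma integral_star_fourier_dotProduct {η : ℂ} (hη : ‖η‖ = 1) {Ψ : State}
    (h : Function.HasFiniteSupport Ψ) (ε : ℝ) :
    ∫ κ in (-Real.pi)..Real.pi, star (fourier η Ψ κ) ⬝ᵥ fourier η Ψ (κ - ε) =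
      2 * Real.pi * ∑' x : ℤ, (positionProb Ψ x : ℂ) * Complex.exp (ε * x * Complex.I) := by
  set s := Set.Finite.toFinset h
  have hs : ∀ x ∉ s, Ψ x = 0 := fun x hx => by
    by_contra hΨ
    exact hx ((Set.Finite.mem_toFinset h).2 hΨ)
  have hF : ∀ κ i, fourier η Ψ κ i =
      ∑ x ∈ s, Complex.exp (-(κ * x * Complex.I)) * η ^ x * Ψ x i := fun κ i =>
    tsum_eq_sum fun x hx => by simp [hs x hx]
  have hη0 : η ≠ 0 := fun h => by simp [h] at hη
  have hηc : conj η * η = 1 := by rw [Complex.conj_mul', hη]; simp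
  have hcomp : ∀ i, ∫ κ in (-Real.pi)..Real.pi, conj (fourier η Ψ κ i) * fourier η Ψ (κ - ε) i =
      2 * Real.pi * ∑ x ∈ s, (‖Ψ x i‖ : ℂ) ^ 2 * Complex.exp (ε * x * Complex.I) := by
    intro i
    have e : ∀ κ : ℝ, conj (fourier η Ψ κ i) * fourier η Ψ (κ - ε) i =
        ∑ x ∈ s, ∑ y ∈ s, (conj η ^ x * η ^ y * conj (Ψ x i) * Ψ y i *
          Complex.exp (ε * y * Complex.I)) *
          Complex.exp (κ * ((x - y : ℤ) : ℂ) * Complex.I) := by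
      intro κ
      rw [hF, hF, map_sum, Finset.sum_mul_sum]
      refine Finset.sum_congr rfl fun x _ => Finset.sum_congr rfl fun y _ => ?_
      have h1 : conj (Complex.exp (-(κ * x * Complex.I))) *
          Complex.exp (-(((κ - ε : ℝ) : ℂ) * y * Complex.I)) =
          Complex.exp (ε * y * Complex.I) * Complex.exp (κ * ((x - y : ℤ) : ℂ) * Complex.I) := by
        rw [← Complex.exp_conj, ← Complex.exp_add, ← Complex.exp_add]
        congr 1
        simp only [map_neg, map_mul, Complex.conj_ofReal, Complex.conj_I, map_intCast]
        push_cast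
        ring
      rw [map_mul, map_mul, map_zpow₀]
      linear_combination (conj η ^ x * η ^ y * conj (Ψ x i) * Ψ y i) * h1
    simp_rw [e]
    rw [intervalIntegral.integral_finsetSum fun x _ => Continuous.intervalIntegrable
      (by fun_prop) _ _, Finset.mul_sum]
    refine Finset.sum_congr rfl fun x hx => ?_
    rw [intervalIntegral.integral_finsetSum fun x _ => Continuous.intervalIntegrable
      (by fun_prop) _ _, Finset.sum_eq_single_of_mem x hx]
    · rw [intervalIntegral.integral_const_mul, integral_exp_int, ← mul_zpow, hηc, one_zpow,
        if_pos (sub_self x), one_mul, Complex.conj_mul']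
      ring
    · intro y _ hy
      rw [intervalIntegral.integral_const_mul, integral_exp_int,
        if_neg (sub_ne_zero.2 (Ne.symm hy)), mul_zero]
  have hcont : ∀ i, Continuous fun κ => fourier η Ψ κ i := fun i => by
    simp_rw [hF]; fun_prop
  have hint : ∀ i, IntervalIntegrable
      (fun κ => conj (fourier η Ψ κ i) * fourier η Ψ (κ - ε) i) volume (-Real.pi) Real.pi :=
    fun i => Continuous.intervalIntegrable
      ((Complex.continuous_conj.comp (hcont i)).mul
        ((hcont i).comp (continuous_id.sub continuous_const))) _ _
  simp only [dotProduct, Fin.sum_univ_two, Pi.star_apply, Complex.star_def]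
  rw [intervalIntegral.integral_add (hint 0) (hint 1), hcomp, hcomp,
    tsum_eq_sum (s := s) fun x hx => by simp [positionProb, hs x hx], ← mul_add,
    ← Finset.sum_add_distrib]
  congr 1
  refine Finset.sum_congr rfl fun x _ => ?_
  unfold positionProb
  push_cast
  ring

/-! ### The characteristic function of the rescaled position -/

section
variable {a b c d : ℂ}

lemma coinU_unitary_relations (hU : coinU a b c d ∈ Matrix.unitaryGroup (Fin 2) ℂ) :
    ‖a‖ ^ 2 + ‖b‖ ^ 2 = 1 ∧ a * conj c + b * conj d = 0 ∧ ‖d‖ = ‖a‖ := by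
  have h1 := Matrix.mem_unitaryGroup_iff'.mp hU
  have h2 := Matrix.mem_unitaryGroup_iff.mp hU
  have e0 := congrFun (congrFun h2 0) 0
  have e1 := congrFun (congrFun h2 0) 1
  have e2 := congrFun (congrFun h1 1) 1
  simp only [coinU, Matrix.mul_apply, Fin.sum_univ_two, Matrix.star_apply, Complex.conj_mul',
    Complex.mul_conj', Matrix.of_apply, Matrix.cons_val', Matrix.cons_val_zero,
    Matrix.cons_val_fin_one, Matrix.cons_val_one, Complex.star_def, Matrix.one_apply_eq,
    Fin.isValue, ne_eq, zero_ne_one, not_false_eq_true, Matrix.one_apply_ne] at e0 e1 e2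
  have e0' : ‖a‖ ^ 2 + ‖b‖ ^ 2 = 1 := by exact_mod_cast e0
  have e2' : ‖b‖ ^ 2 + ‖d‖ ^ 2 = 1 := by exact_mod_cast e2
  refine ⟨e0', e1, ?_⟩
  exact (pow_left_inj₀ (norm_nonneg _) (norm_nonneg _) two_ne_zero).1 (by linarith)

/-- With the twist `η² = a / d`, one period of the walk acts on Fourier transforms as `stepMatrix`,
up to a constant phase. -/
lemma three_step_symbol (ha : a ≠ 0) (hd : d ≠ 0) (hab : ‖a‖ ^ 2 + ‖b‖ ^ 2 = 1)
    (horth : a * conj c + b * conj d = 0) {η : ℂ} (hη : η ^ 2 = a / d) (κ : ℝ) :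
    shiftMatrix η κ * (coinJ a d * (shiftMatrix η κ * (coinU a b c d *
      (shiftMatrix η κ * coinU a b c d)))) =
      (Complex.I * η⁻¹ * (d / conj a)) • stepMatrix a b κ := by
  have hη0 : η ≠ 0 := fun h => by
    rw [h] at hη
    exact div_ne_zero ha hd (by simpa using hη.symm)
  have ha' : conj a ≠ 0 := by simpa using ha
  -- `Δ` is the determinant of the coin: unitarity gives `d = Δ * conj a` and `c = -Δ * conj b`, and the
  -- choice of `η` turns `a` into `η² * Δ * conj a`, so that each entry is a polynomial identity.
  obtain ⟨Δ, hΔ⟩ : ∃ Δ, Δ = d / conj a := ⟨_, rfl⟩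
  have hdΔ : d = Δ * conj a := by rw [hΔ]; field_simp
  have hΔ0 : Δ ≠ 0 := fun h => hd (by rw [hdΔ, h, zero_mul])
  have haη : a = η ^ 2 * Δ * conj a := by rw [hη, mul_assoc, ← hdΔ]; field_simp
  have horth' : conj a * c + conj b * d = 0 := by
    have := congrArg conj horth
    simpa using this
  have hc : c = -(Δ * conj b) := by
    apply mul_left_cancel₀ ha'
    rw [hdΔ] at horth'
    linear_combination horth'
  have hab' : a * conj a + b * conj b = 1 := by
    rw [Complex.mul_conj', Complex.mul_conj']
    exact_mod_cast hab
  have hp : ((‖a‖ ^ 2 : ℝ) : ℂ) = a * conj a := by rw [Complex.mul_conj']; push_cast; rfl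
  have hw : Complex.exp (κ * Complex.I) ≠ 0 := Complex.exp_ne_zero _
  have hexp2 : Complex.exp (2 * κ * Complex.I) = Complex.exp (κ * Complex.I) ^ 2 := by
    rw [← Complex.exp_nat_mul]; ring_nf
  rw [← hΔ, hc, hdΔ]
  unfold stepMatrix bandMatrix bandArg coinJ coinU shiftMatrix
  simp only [Complex.ofReal_mul, Complex.ofReal_sub, Complex.ofReal_add, Complex.ofReal_pow,
    Complex.ofReal_cos, Complex.ofReal_sin, Complex.ofReal_one, Complex.ofReal_ofNat,
    Complex.exp_neg, hexp2, Complex.cos, Complex.sin, neg_mul]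
  have hp' : (‖a‖ : ℂ) ^ 2 = a * conj a := by rw [← hp]; push_cast; rfl
  rw [hp']
  generalize Complex.exp (κ * Complex.I) = w at hw
  clear hexp2 hp hp' hη horth horth' hc hdΔ hΔ hab
  generalize conj a = a' at *
  generalize conj b = b' at *
  ext i j
  fin_cases i <;> fin_cases j <;>
    simp [Matrix.mul_apply, Fin.sum_univ_two]
  all_goals field_simp
  all_goals ring_nf
  all_goals simp only [Complex.I_sq]
  all_goals ring_nf
  · linear_combination (-8 * w ^ 4 * η ^ 2 * Δ) * hab' + 8 * w ^ 6 * a * haη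
  · linear_combination (b * w ^ 2) * haη
  · linear_combination (b' * w ^ 2 * a + b' * (a + η ^ 2 * Δ * a')) * haη
  · linear_combination (8 * a * w ^ 2) * hab' +
      (-8 * w ^ 2 * b * b' + 8 * a' * (a + η ^ 2 * Δ * a')) * haη

lemma walk_three_mul_succ (a b c d α β : ℂ) (t : ℕ) : walk a b c d α β (3 * (t + 1)) =
    shift (coin (coinJ a d) (shift (coin (coinU a b c d) (shift (coin (coinU a b c d)
      (walk a b c d α β (3 * t))))))) := by
  rw [show 3 * (t + 1) = 3 * t + 2 + 1 by ring, walk, if_pos (by omega), walk,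
    if_neg (by omega), walk, if_neg (by omega)]

lemma fourier_initialState (η α β : ℂ) (κ : ℝ) :
    fourier η (initialState α β) κ = ![α, β] := by
  ext i
  simp only [fourier]
  rw [tsum_eq_single 0 fun x hx => by simp [initialState, hx]]
  simp [initialState]

lemma fourier_walk (ha : a ≠ 0) (hd : d ≠ 0) (hab : ‖a‖ ^ 2 + ‖b‖ ^ 2 = 1)
    (horth : a * conj c + b * conj d = 0) {η : ℂ} (hη : η ^ 2 = a / d) (α β : ℂ) (κ : ℝ) (t : ℕ) :
    fourier η (walk a b c d α β (3 * t)) κ =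
      (Complex.I * η⁻¹ * (d / conj a)) ^ t • (stepMatrix a b κ ^ t *ᵥ ![α, β]) := by
  have hη0 : η ≠ 0 := fun h => by
    rw [h] at hη
    exact div_ne_zero ha hd (by simpa using hη.symm)
  induction t with
  | zero => simp [walk, fourier_initialState]
  | succ t ih =>
    have h0 := hasFiniteSupport_walk a b c d α β (3 * t)
    have h1 := hasFiniteSupport_shift (hasFiniteSupport_coin h0 (coinU a b c d))
    have h2 := hasFiniteSupport_shift (hasFiniteSupport_coin h1 (coinU a b c d))
    rw [walk_three_mul_succ, fourier_shift hη0, fourier_coin h2, fourier_shift hη0,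
      fourier_coin h1, fourier_shift hη0, fourier_coin h0, ih]
    simp only [Matrix.mulVec_mulVec]
    rw [three_step_symbol ha hd hab horth hη, Matrix.smul_mulVec, Matrix.mulVec_smul,
      Matrix.mulVec_mulVec, smul_smul, ← pow_succ', ← pow_succ']

end

/-- The law of `X_{3t} / (3t)`. -/
def rescaledLaw (a b c d α β : ℂ) (t : ℕ) : Measure ℝ :=
  (positionLaw a b c d α β (3 * t)).map fun n : ℤ => (n : ℝ) / (3 * (t : ℝ))

lemma positionProb_nonneg (Ψ : State) (x : ℤ) : 0 ≤ positionProb Ψ x := by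
  unfold positionProb; positivity

section
variable {a b c d α β : ℂ}

lemma charFun_rescaledLaw (ha : a ≠ 0) (hd : d ≠ 0)
    (hU : coinU a b c d ∈ Matrix.unitaryGroup (Fin 2) ℂ) (t : ℕ) (ξ : ℝ) :
    charFun (rescaledLaw a b c d α β t) ξ = (2 * Real.pi : ℂ)⁻¹ *
      ∫ κ in (-Real.pi)..Real.pi, star (stepMatrix a b κ ^ t *ᵥ ![α, β]) ⬝ᵥ
        (stepMatrix a b (κ - ξ / (3 * t)) ^ t *ᵥ ![α, β]) := by
  obtain ⟨hab, horth, hnorm⟩ := coinU_unitary_relations hU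
  obtain ⟨η, hη⟩ := IsAlgClosed.exists_pow_nat_eq (a / d) zero_lt_two
  have hη1 : ‖η‖ = 1 := by
    have h : ‖η‖ ^ 2 = 1 := by
      rw [← norm_pow, hη, norm_div, hnorm, div_self (norm_ne_zero_iff.2 ha)]
    exact (pow_eq_one_iff_of_nonneg (norm_nonneg _) two_ne_zero).1 h
  have hphase : ‖(Complex.I * η⁻¹ * (d / conj a)) ^ t‖ = 1 := by
    simp [hη1, hnorm, ha]
  have hP := integral_star_fourier_dotProduct hη1
    (hasFiniteSupport_walk a b c d α β (3 * t)) (ξ / (3 * t))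
  have hπ : (2 * Real.pi : ℂ) ≠ 0 := by simp [Real.pi_ne_zero]
  rw [eq_inv_mul_iff_mul_eq₀ hπ, charFun_apply_real, rescaledLaw,
    integral_map (by fun_prop) (by fun_prop), positionLaw,
    integral_sum_dirac fun _ => ENNReal.ofReal_ne_top]
  have e : ∀ κ : ℝ, star (fourier η (walk a b c d α β (3 * t)) κ) ⬝ᵥ
      fourier η (walk a b c d α β (3 * t)) (κ - ξ / (3 * t)) =
      star (stepMatrix a b κ ^ t *ᵥ ![α, β]) ⬝ᵥ
        (stepMatrix a b (κ - ξ / (3 * t)) ^ t *ᵥ ![α, β]) := by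
    intro κ
    rw [fourier_walk ha hd hab horth hη, fourier_walk ha hd hab horth hη, star_smul,
      smul_dotProduct, dotProduct_smul, smul_smul, Complex.star_def, Complex.conj_mul', hphase]
    simp
  simp_rw [e] at hP
  rw [hP]
  congr 1
  refine tsum_congr fun x => ?_
  rw [ENNReal.toReal_ofReal (positionProb_nonneg _ _), Complex.real_smul]
  congr 2
  push_cast
  ring

lemma tendsto_charFun_rescaledLaw (ha : a ≠ 0) (hd : d ≠ 0) (hb : b ≠ 0)
    (hU : coinU a b c d ∈ Matrix.unitaryGroup (Fin 2) ℂ) (hαβ : ‖α‖ ^ 2 + ‖β‖ ^ 2 = 1) (ξ : ℝ) :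
    Tendsto (fun t => charFun (rescaledLaw a b c d α β t) ξ) atTop
      (𝓝 ((2 * Real.pi : ℂ)⁻¹ * ∫ κ in (-Real.pi)..Real.pi,
        (((1 + bandExpectation a b α β κ : ℝ) : ℂ) / 2 *
            Complex.exp (-(ξ * velocity (‖a‖ ^ 2) κ : ℝ) * Complex.I) +
          ((1 - bandExpectation a b α β κ : ℝ) : ℂ) / 2 *
            Complex.exp ((ξ * velocity (‖a‖ ^ 2) κ : ℝ) * Complex.I)))) := by
  obtain ⟨hab, -, -⟩ := coinU_unitary_relations hU
  have h0 : 0 < ‖a‖ ^ 2 := by positivity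
  have h1 : ‖a‖ ^ 2 < 1 := by
    have : 0 < ‖b‖ ^ 2 := by positivity
    linarith
  simp_rw [charFun_rescaledLaw ha hd hU]
  refine Tendsto.const_mul _ ?_
  refine intervalIntegral.tendsto_integral_filter_of_dominated_convergence (fun _ => 1) ?_ ?_ ?_ ?_
  · refine Eventually.of_forall fun t => Continuous.aestronglyMeasurable ?_
    have hM := continuous_stepMatrix a b
    have h2 : Continuous fun κ => stepMatrix a b κ ^ t *ᵥ ![α, β] :=
      (hM.pow t).matrix_mulVec continuous_const
    have h3 : Continuous fun κ => stepMatrix a b (κ - ξ / (3 * t)) ^ t *ᵥ ![α, β] :=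
      h2.comp (continuous_id.sub continuous_const)
    exact h2.star.dotProduct h3
  · have hu : ∀ (κ : ℝ) (t : ℕ), star (stepMatrix a b κ ^ t *ᵥ ![α, β]) ⬝ᵥ
        (stepMatrix a b κ ^ t *ᵥ ![α, β]) = 1 := fun κ t => by
      rw [star_dotProduct_mulVec_unitary (pow_mem (stepMatrix_mem h0 h1 hab κ) t),
        star_dotProduct_self]
      simpa using congrArg ((↑) : ℝ → ℂ) hαβ
    exact Eventually.of_forall fun t => Eventually.of_forall fun κ _ =>
      norm_star_dotProduct_le (hu _ _) (hu _ _)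
  · exact intervalIntegrable_const
  · exact Eventually.of_forall fun κ _ => tendsto_star_dotProduct h0 h1 hab hαβ κ ξ

end

/-! ### The limit law -/

section
variable {a b : ℂ}

lemma continuous_χ (a b α β : ℂ) : Continuous (χ a b α β) := by
  unfold χ D; fun_prop

lemma continuous_bandExpectation (h0 : 0 < ‖a‖ ^ 2) (h1 : ‖a‖ ^ 2 < 1) (α β : ℂ) :
    Continuous (bandExpectation a b α β) := by
  have := continuous_bandArg (‖a‖ ^ 2)
  unfold bandExpectation
  refine Continuous.div ?_ (continuous_gap _) fun κ => (gap_pos h0 h1 κ).ne'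
  fun_prop

lemma bandArg_neg (p κ : ℝ) : bandArg p (-κ) = bandArg p κ := by simp [bandArg]

lemma bandArg_add_pi (p κ : ℝ) : bandArg p (κ + Real.pi) = bandArg p κ := by simp [bandArg]

lemma gap_neg (p κ : ℝ) : gap p (-κ) = gap p κ := by simp [gap, gapSq, bandArg_neg]

lemma gap_add_pi (p κ : ℝ) : gap p (κ + Real.pi) = gap p κ := by simp [gap, gapSq, bandArg_add_pi]

lemma velocity_neg (p κ : ℝ) : velocity p (-κ) = velocity p κ := by
  simp [velocity, gap_neg, bandArg_neg]

lemma velocity_add_pi (p κ : ℝ) : velocity p (κ + Real.pi) = velocity p κ := by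
  simp [velocity, gap_add_pi, bandArg_add_pi]

lemma bandExpectation_add_pi (a b α β : ℂ) (κ : ℝ) :
    bandExpectation a b α β (κ + Real.pi) = bandExpectation a b α β κ := by
  unfold bandExpectation
  rw [bandArg_add_pi, gap_add_pi, show -(2 * ((κ + Real.pi : ℝ) : ℂ) * Complex.I) =
    -(2 * κ * Complex.I) - 2 * Real.pi * Complex.I by push_cast; ring, Complex.exp_sub,
    Complex.exp_two_pi_mul_I, div_one]

/-- Reflecting the wave number removes the part of the expectation proportional to `sin 2κ`, which
`χ` does not see. -/
lemma bandExpectation_add_neg (h0 : 0 < ‖a‖ ^ 2) (h1 : ‖a‖ ^ 2 < 1)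
    (hab : ‖a‖ ^ 2 + ‖b‖ ^ 2 = 1) (α β : ℂ) (κ : ℝ) :
    bandExpectation a b α β κ + bandExpectation a b α β (-κ) =
      2 * χ a b α β (velocity (‖a‖ ^ 2) κ) := by
  rw [χ_velocity h0 h1 hab]
  unfold bandExpectation
  rw [bandArg_neg, gap_neg]
  generalize a * α * conj (b * β) = T
  have e1 : (T * Complex.exp (-(2 * κ * Complex.I))).re +
      (T * Complex.exp (-(2 * ((-κ : ℝ) : ℂ) * Complex.I))).re =
      2 * Real.cos (2 * κ) * T.re := by
    rw [← Complex.add_re, ← mul_add, add_comm (Complex.exp _),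
      show -(2 * ((-κ : ℝ) : ℂ) * Complex.I) = ((2 * κ : ℝ) : ℂ) * Complex.I by push_cast; ring,
      show -(2 * (κ : ℂ) * Complex.I) = -((2 * κ : ℝ) : ℂ) * Complex.I by push_cast; ring,
      ← Complex.two_cos, ← Complex.ofReal_cos,
      show (2 : ℂ) * ((Real.cos (2 * κ) : ℝ) : ℂ) = ((2 * Real.cos (2 * κ) : ℝ) : ℂ) by
        push_cast; rfl,
      Complex.re_mul_ofReal]
    ring
  rw [← add_div, ← mul_div_assoc]
  congr 1
  linear_combination (-4) * e1

/-- The weights `(1 ± bandExpectation) / 2` of the branches are squared norms, hence nonnegative. -/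
lemma abs_bandExpectation_le_one (h0 : 0 < ‖a‖ ^ 2) (h1 : ‖a‖ ^ 2 < 1)
    (hab : ‖a‖ ^ 2 + ‖b‖ ^ 2 = 1) {α β : ℂ} (hαβ : ‖α‖ ^ 2 + ‖β‖ ^ 2 = 1) (κ : ℝ) :
    |bandExpectation a b α β κ| ≤ 1 := by
  have hφ1 : star ![α, β] ⬝ᵥ ![α, β] = 1 := by
    rw [star_dotProduct_self]; simpa using congrArg ((↑) : ℝ → ℂ) hαβ
  have key : ∀ σ : ℝ, σ ^ 2 = 1 → 0 ≤ 1 + σ * bandExpectation a b α β κ := by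
    intro σ hσ
    have h := star_dotProduct_bandVector h0 h1 hab ![α, β] σ σ κ
    rw [star_dotProduct_self, hφ1, star_dotProduct_bandMatrix, ← pow_two, hσ] at h
    have h' : ‖bandVector a b ![α, β] σ κ 0‖ ^ 2 + ‖bandVector a b ![α, β] σ κ 1‖ ^ 2 =
      (1 + 1) / 4 * 1 + (σ + σ) / 4 * bandExpectation a b α β κ := by exact_mod_cast h
    have h'' : 0 ≤ ‖bandVector a b ![α, β] σ κ 0‖ ^ 2 + ‖bandVector a b ![α, β] σ κ 1‖ ^ 2 := by
      positivity
    linarith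
  rw [abs_le]
  constructor
  · linarith [key 1 (by norm_num)]
  · linarith [key (-1) (by norm_num)]

lemma abs_χ_velocity_le_one (h0 : 0 < ‖a‖ ^ 2) (h1 : ‖a‖ ^ 2 < 1)
    (hab : ‖a‖ ^ 2 + ‖b‖ ^ 2 = 1) {α β : ℂ} (hαβ : ‖α‖ ^ 2 + ‖β‖ ^ 2 = 1) (κ : ℝ) :
    |χ a b α β (velocity (‖a‖ ^ 2) κ)| ≤ 1 := by
  have h := bandExpectation_add_neg h0 h1 hab α β κ
  have h2 := abs_le.1 (abs_bandExpectation_le_one h0 h1 hab hαβ κ)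
  have h3 := abs_le.1 (abs_bandExpectation_le_one h0 h1 hab hαβ (-κ))
  rw [abs_le]
  constructor <;> linarith

section
variable {E : Type*} [NormedAddCommGroup E] [NormedSpace ℝ E]

lemma velocityDeriv_smul_f_smul (h0 : 0 < ‖a‖ ^ 2) (h1 : ‖a‖ ^ 2 < 1)
    (hab : ‖a‖ ^ 2 + ‖b‖ ^ 2 = 1) (G : ℝ → E) :
    (fun κ => velocityDeriv (‖a‖ ^ 2) κ • (f a b (velocity (‖a‖ ^ 2) κ) •
      G (velocity (‖a‖ ^ 2) κ))) =ᵐ[volume.restrict (Set.Icc 0 (Real.pi / 2))]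
      fun κ => Real.pi⁻¹ • G (velocity (‖a‖ ^ 2) κ) := by
  rw [← restrict_Ioo_eq_restrict_Icc]
  filter_upwards [ae_restrict_mem measurableSet_Ioo] with κ hκ
  rw [smul_smul, velocityDeriv_mul_f h0 h1 hab hκ, one_div]

lemma setIntegral_f_smul (h0 : 0 < ‖a‖ ^ 2) (h1 : ‖a‖ ^ 2 < 1) (hab : ‖a‖ ^ 2 + ‖b‖ ^ 2 = 1)
    (G : ℝ → E) : ∫ y in Set.Ioo (innerEnd a) (outerEnd a), f a b y • G y =
      Real.pi⁻¹ • ∫ κ in 0..(Real.pi / 2), G (velocity (‖a‖ ^ 2) κ) := by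
  have hpi : (0 : ℝ) ≤ Real.pi / 2 := by positivity
  rw [← integral_Icc_eq_integral_Ioo, ← velocity_zero, ← velocity_pi_div_two,
    ← integral_Icc_deriv_smul_of_deriv_nonneg (continuous_velocity h0 h1).continuousOn
      (fun κ _ => hasDerivAt_velocity h0 h1 κ) (fun κ hκ => (velocityDeriv_pos h0 h1 hκ).le) hpi,
    integral_congr_ae (velocityDeriv_smul_f_smul h0 h1 hab G), integral_smul,
    intervalIntegral.integral_of_le hpi, integral_Icc_eq_integral_Ioc]

lemma integrableOn_f_smul (h0 : 0 < ‖a‖ ^ 2) (h1 : ‖a‖ ^ 2 < 1) (hab : ‖a‖ ^ 2 + ‖b‖ ^ 2 = 1)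
    {G : ℝ → E} (hG : Continuous G) :
    IntegrableOn (fun y => f a b y • G y) (Set.Ioo (innerEnd a) (outerEnd a)) := by
  have hpi : (0 : ℝ) ≤ Real.pi / 2 := by positivity
  rw [← integrableOn_Icc_iff_integrableOn_Ioo, ← velocity_zero, ← velocity_pi_div_two,
    ← integrableOn_Icc_deriv_smul_iff_of_deriv_nonneg (continuous_velocity h0 h1).continuousOn
      (fun κ _ => hasDerivAt_velocity h0 h1 κ) (fun κ hκ => (velocityDeriv_pos h0 h1 hκ).le) hpi,
    IntegrableOn, integrable_congr (velocityDeriv_smul_f_smul h0 h1 hab G)]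
  exact ((hG.comp (continuous_velocity h0 h1)).const_smul Real.pi⁻¹).integrableOn_Icc

end

/-- The contribution to the limit density of one branch: for `s = 1` the branch moving
with velocity `velocity`, and for `s = -1` the other one, reflected at the origin. -/
def branchDensity (a b α β : ℂ) (s : ℝ) : ℝ → ℝ :=
  (Set.Ioo (innerEnd a) (outerEnd a)).indicator fun y => f a b y * (1 - s * χ a b α β y)

lemma limitDensity_eq (a b α β : ℂ) (y : ℝ) : limitDensity a b α β y =
    branchDensity a b α β 1 y + branchDensity a b α β (-1) (-y) := by
  have h : -y ∈ Set.Ioo (innerEnd a) (outerEnd a) ↔ y ∈ Set.Ioo (-outerEnd a) (-innerEnd a) := by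
    simp only [Set.mem_Ioo]; constructor <;> rintro ⟨h, h'⟩ <;> constructor <;> linarith
  unfold limitDensity branchDensity
  simp only [Set.indicator_apply, h, Pi.one_apply]
  split_ifs <;> ring

lemma branchDensity_nonneg (h0 : 0 < ‖a‖ ^ 2) (h1 : ‖a‖ ^ 2 < 1) (hab : ‖a‖ ^ 2 + ‖b‖ ^ 2 = 1)
    {α β : ℂ} (hαβ : ‖α‖ ^ 2 + ‖β‖ ^ 2 = 1) {s : ℝ} (hs : |s| = 1) (y : ℝ) :
    0 ≤ branchDensity a b α β s y := by
  refine Set.indicator_nonneg (fun y hy => ?_) y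
  rw [← velocity_zero, ← velocity_pi_div_two] at hy
  obtain ⟨κ, hκ, rfl⟩ := intermediate_value_Ioo (by positivity)
    (continuous_velocity h0 h1).continuousOn hy
  have hf : 0 ≤ f a b (velocity (‖a‖ ^ 2) κ) := by
    refine nonneg_of_mul_nonneg_right ?_ (velocityDeriv_pos h0 h1 hκ)
    rw [velocityDeriv_mul_f h0 h1 hab hκ]
    positivity
  refine mul_nonneg hf ?_
  have h : |s * χ a b α β (velocity (‖a‖ ^ 2) κ)| ≤ 1 := by
    rw [abs_mul, hs, one_mul]; exact abs_χ_velocity_le_one h0 h1 hab hαβ κ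
  linarith [(abs_le.1 h).2]

lemma integrable_branchDensity (h0 : 0 < ‖a‖ ^ 2) (h1 : ‖a‖ ^ 2 < 1)
    (hab : ‖a‖ ^ 2 + ‖b‖ ^ 2 = 1) (α β : ℂ) (s : ℝ) :
    Integrable (branchDensity a b α β s) := by
  rw [branchDensity, integrable_indicator_iff measurableSet_Ioo]
  exact integrableOn_f_smul h0 h1 hab (G := fun y => 1 - s * χ a b α β y)
    (continuous_const.sub (continuous_const.mul (continuous_χ a b α β)))

lemma integral_branchDensity_smul {E : Type*} [NormedAddCommGroup E] [NormedSpace ℝ E]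
    (h0 : 0 < ‖a‖ ^ 2) (h1 : ‖a‖ ^ 2 < 1)
    (hab : ‖a‖ ^ 2 + ‖b‖ ^ 2 = 1) (α β : ℂ) (s : ℝ) (G : ℝ → E) :
    ∫ y, branchDensity a b α β s y • G y = Real.pi⁻¹ • ∫ κ in 0..(Real.pi / 2),
      (1 - s * χ a b α β (velocity (‖a‖ ^ 2) κ)) • G (velocity (‖a‖ ^ 2) κ) := by
  rw [← setIntegral_f_smul h0 h1 hab fun y => (1 - s * χ a b α β y) • G y,
    ← integral_indicator measurableSet_Ioo]
  refine integral_congr_ae (Eventually.of_forall fun y => ?_)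
  simp only [branchDensity, Set.indicator_apply]
  split_ifs
  · rw [mul_smul]
  · rw [zero_smul]

lemma integrable_limitDensity (h0 : 0 < ‖a‖ ^ 2) (h1 : ‖a‖ ^ 2 < 1)
    (hab : ‖a‖ ^ 2 + ‖b‖ ^ 2 = 1) (α β : ℂ) : Integrable (limitDensity a b α β) := by
  rw [show limitDensity a b α β = fun y => branchDensity a b α β 1 y +
    branchDensity a b α β (-1) (-y) from funext (limitDensity_eq a b α β)]
  exact (integrable_branchDensity h0 h1 hab α β 1).add
    (integrable_branchDensity h0 h1 hab α β (-1)).comp_neg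

lemma limitDensity_nonneg (h0 : 0 < ‖a‖ ^ 2) (h1 : ‖a‖ ^ 2 < 1)
    (hab : ‖a‖ ^ 2 + ‖b‖ ^ 2 = 1) {α β : ℂ} (hαβ : ‖α‖ ^ 2 + ‖β‖ ^ 2 = 1) (y : ℝ) :
    0 ≤ limitDensity a b α β y := by
  rw [limitDensity_eq]
  exact add_nonneg (branchDensity_nonneg h0 h1 hab hαβ (by simp) y)
    (branchDensity_nonneg h0 h1 hab hαβ (by simp) (-y))

lemma integral_limitDensity_smul {E : Type*} [NormedAddCommGroup E] [NormedSpace ℝ E]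
    (h0 : 0 < ‖a‖ ^ 2) (h1 : ‖a‖ ^ 2 < 1)
    (hab : ‖a‖ ^ 2 + ‖b‖ ^ 2 = 1) (α β : ℂ) {G : ℝ → E} (hG : Continuous G) {C : ℝ}
    (hC : ∀ y, ‖G y‖ ≤ C) :
    ∫ y, limitDensity a b α β y • G y = Real.pi⁻¹ • ∫ κ in 0..(Real.pi / 2),
      ((1 - χ a b α β (velocity (‖a‖ ^ 2) κ)) • G (velocity (‖a‖ ^ 2) κ) +
        (1 + χ a b α β (velocity (‖a‖ ^ 2) κ)) • G (-velocity (‖a‖ ^ 2) κ)) := by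
  have i1 : Integrable fun y => branchDensity a b α β 1 y • G y :=
    (integrable_branchDensity h0 h1 hab α β 1).smul_bdd C hG.aestronglyMeasurable
      (Eventually.of_forall hC)
  have i2 : Integrable fun y => branchDensity a b α β (-1) y • G (-y) :=
    (integrable_branchDensity h0 h1 hab α β (-1)).smul_bdd C
      (hG.comp continuous_neg).aestronglyMeasurable (Eventually.of_forall fun y => hC (-y))
  have i3 : Integrable fun y => branchDensity a b α β (-1) (-y) • G y := by
    simpa using i2.comp_neg
  have hv := continuous_velocity h0 h1
  have hχ := (continuous_χ a b α β).comp hv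
  simp_rw [limitDensity_eq, add_smul]
  rw [integral_add i1 i3, ← integral_neg_eq_self fun y => branchDensity a b α β (-1) (-y) • G y]
  simp only [neg_neg]
  rw [integral_branchDensity_smul h0 h1 hab, integral_branchDensity_smul h0 h1 hab α β (-1)
    fun y => G (-y), ← smul_add, ← intervalIntegral.integral_add]
  · simp only [one_mul, neg_mul, sub_neg_eq_add, add_smul]
  · exact Continuous.intervalIntegrable
      ((continuous_const.sub (continuous_const.mul hχ)).smul (hG.comp hv)) _ _
  · exact Continuous.intervalIntegrable
      ((continuous_const.sub (continuous_const.mul hχ)).smul (hG.comp hv.neg)) _ _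

lemma integral_limitDensity (h0 : 0 < ‖a‖ ^ 2) (h1 : ‖a‖ ^ 2 < 1)
    (hab : ‖a‖ ^ 2 + ‖b‖ ^ 2 = 1) (α β : ℂ) : ∫ y, limitDensity a b α β y = 1 := by
  have h := integral_limitDensity_smul h0 h1 hab α β (G := fun _ => (1 : ℝ)) continuous_const
    (C := 1) (by simp)
  simp only [smul_eq_mul, mul_one, sub_add_add_cancel] at h
  rw [h, intervalIntegral.integral_const]
  have := Real.pi_ne_zero
  simp only [sub_zero, smul_eq_mul]
  field_simp
  norm_num

/-- The measure with density `limitDensity`. -/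
def limitLaw (a b α β : ℂ) : Measure ℝ :=
  volume.withDensity fun y => ENNReal.ofReal (limitDensity a b α β y)

lemma charFun_limitLaw (h0 : 0 < ‖a‖ ^ 2) (h1 : ‖a‖ ^ 2 < 1)
    (hab : ‖a‖ ^ 2 + ‖b‖ ^ 2 = 1) {α β : ℂ} (hαβ : ‖α‖ ^ 2 + ‖β‖ ^ 2 = 1) (ξ : ℝ) :
    charFun (limitLaw a b α β) ξ = Real.pi⁻¹ • ∫ κ in 0..(Real.pi / 2),
      ((1 - χ a b α β (velocity (‖a‖ ^ 2) κ)) •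
          Complex.exp (ξ * (velocity (‖a‖ ^ 2) κ : ℝ) * Complex.I) +
        (1 + χ a b α β (velocity (‖a‖ ^ 2) κ)) •
          Complex.exp (ξ * (-velocity (‖a‖ ^ 2) κ : ℝ) * Complex.I)) := by
  rw [charFun_apply_real, limitLaw, integral_withDensity_eq_integral_toReal_smul₀
    (integrable_limitDensity h0 h1 hab α β).aemeasurable.ennreal_ofReal
    (Eventually.of_forall fun _ => ENNReal.ofReal_lt_top)]
  simp_rw [ENNReal.toReal_ofReal (limitDensity_nonneg h0 h1 hab hαβ _)]
  refine integral_limitDensity_smul h0 h1 hab α β (by fun_prop) (C := 1) fun y => ?_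
  rw [← Complex.ofReal_mul, Complex.norm_exp_ofReal_mul_I]

lemma isProbabilityMeasure_limitLaw (h0 : 0 < ‖a‖ ^ 2) (h1 : ‖a‖ ^ 2 < 1)
    (hab : ‖a‖ ^ 2 + ‖b‖ ^ 2 = 1) {α β : ℂ} (hαβ : ‖α‖ ^ 2 + ‖β‖ ^ 2 = 1) :
    IsProbabilityMeasure (limitLaw a b α β) := by
  refine ⟨?_⟩
  rw [limitLaw, withDensity_apply _ MeasurableSet.univ, Measure.restrict_univ,
    ← ofReal_integral_eq_lintegral_ofReal (integrable_limitDensity h0 h1 hab α β)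
      (Eventually.of_forall (limitDensity_nonneg h0 h1 hab hαβ)),
    integral_limitDensity h0 h1 hab, ENNReal.ofReal_one]

/-- The symmetries `κ ↦ κ + π` and `κ ↦ -κ` fold the circle onto the quarter `[0, π / 2]`. -/
lemma integral_fold {E : Type*} [NormedAddCommGroup E] [NormedSpace ℝ E] {H : ℝ → E}
    (hH : Continuous H) (hper : Function.Periodic H Real.pi) :
    ∫ κ in (-Real.pi)..Real.pi, H κ =
      (2 : ℝ) • ∫ κ in 0..(Real.pi / 2), (H κ + H (-κ)) := by
  have hi : ∀ x y, IntervalIntegrable H volume x y := fun x y => hH.intervalIntegrable x y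
  have hn : IntervalIntegrable (fun κ => H (-κ)) volume 0 (Real.pi / 2) :=
    (hH.comp continuous_neg).intervalIntegrable _ _
  have e1 := hper.intervalIntegral_add_eq (-Real.pi) (-(Real.pi / 2))
  have e2 := hper.intervalIntegral_add_eq 0 (-(Real.pi / 2))
  rw [neg_add_cancel, show -(Real.pi / 2) + Real.pi = Real.pi / 2 by ring] at e1
  rw [zero_add, show -(Real.pi / 2) + Real.pi = Real.pi / 2 by ring] at e2
  rw [← intervalIntegral.integral_add_adjacent_intervals (hi _ 0) (hi 0 _), e1, e2, ← two_smul ℝ,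
    ← intervalIntegral.integral_add_adjacent_intervals (hi _ 0) (hi 0 _),
    intervalIntegral.integral_add (hi _ _) hn,
    intervalIntegral.integral_comp_neg, neg_zero, add_comm]

lemma tendsto_charFun_limitLaw {a b c d α β : ℂ} (ha : a ≠ 0) (hd : d ≠ 0) (hb : b ≠ 0)
    (hU : coinU a b c d ∈ Matrix.unitaryGroup (Fin 2) ℂ) (hαβ : ‖α‖ ^ 2 + ‖β‖ ^ 2 = 1) (ξ : ℝ) :
    Tendsto (fun t => charFun (rescaledLaw a b c d α β t) ξ) atTop
      (𝓝 (charFun (limitLaw a b α β) ξ)) := by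
  obtain ⟨hab, -, -⟩ := coinU_unitary_relations hU
  have h0 : 0 < ‖a‖ ^ 2 := by positivity
  have h1 : ‖a‖ ^ 2 < 1 := by
    have : 0 < ‖b‖ ^ 2 := by positivity
    linarith
  have h := tendsto_charFun_rescaledLaw ha hd hb hU hαβ ξ
  have hv := continuous_velocity h0 h1
  have hX := continuous_bandExpectation (b := b) h0 h1 α β
  rw [integral_fold (by fun_prop) fun κ => by
    simp only [bandExpectation_add_pi, velocity_add_pi]] at h
  convert h using 2
  rw [charFun_limitLaw h0 h1 hab hαβ, Complex.real_smul, Complex.real_smul, ← mul_assoc]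
  congr 1
  · push_cast
    have : (Real.pi : ℂ) ≠ 0 := by simp [Real.pi_ne_zero]
    field_simp
  · refine intervalIntegral.integral_congr fun κ _ => ?_
    have hx : (bandExpectation a b α β κ : ℂ) + (bandExpectation a b α β (-κ) : ℂ) =
      2 * (χ a b α β (velocity (‖a‖ ^ 2) κ) : ℂ) := by
      exact_mod_cast bandExpectation_add_neg h0 h1 hab α β κ
    simp only [velocity_neg, Complex.real_smul]
    push_cast
    rw [show (ξ : ℂ) * -(velocity (‖a‖ ^ 2) κ : ℂ) * Complex.I =
      -(ξ * (velocity (‖a‖ ^ 2) κ : ℂ)) * Complex.I by ring]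
    linear_combination (1 / 2 * (Complex.exp (ξ * (velocity (‖a‖ ^ 2) κ : ℂ) * Complex.I) -
      Complex.exp (-(ξ * (velocity (‖a‖ ^ 2) κ : ℂ)) * Complex.I))) * hx

end

end ThreePeriodWalk

end

/-! ### Convergence in distribution -/

theorem mainTheorem2 (a b c d α β : ℂ)
    (hU : ThreePeriodWalk.coinU a b c d ∈ Matrix.unitaryGroup (Fin 2) ℂ)
    (habcd : a * b * c * d ≠ 0)
    (hαβ : ‖α‖ ^ 2 + ‖β‖ ^ 2 = 1) :
    -- the limit is a probability density ...
    (∀ᵐ y : ℝ, 0 ≤ ThreePeriodWalk.limitDensity a b α β y) ∧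
    Integrable (ThreePeriodWalk.limitDensity a b α β) ∧
    (∫ y : ℝ, ThreePeriodWalk.limitDensity a b α β y) = 1 ∧
    -- ... and the distribution functions of `X_{3t} / (3t)` converge to its distribution function
    ∀ x : ℝ, Tendsto
      (fun t : ℕ => (ThreePeriodWalk.positionLaw a b c d α β (3 * t)).real
        {n : ℤ | (n : ℝ) / (3 * (t : ℝ)) ≤ x})
      atTop
      (𝓝 (∫ y in Set.Iic x, ThreePeriodWalk.limitDensity a b α β y)) := by
  open ThreePeriodWalk in
  have hd : d ≠ 0 := right_ne_zero_of_mul habcd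
  have hb : b ≠ 0 := right_ne_zero_of_mul (left_ne_zero_of_mul (left_ne_zero_of_mul habcd))
  have ha : a ≠ 0 := left_ne_zero_of_mul (left_ne_zero_of_mul (left_ne_zero_of_mul habcd))
  obtain ⟨hab, -, -⟩ := coinU_unitary_relations hU
  have h0 : 0 < ‖a‖ ^ 2 := by positivity
  have h1 : ‖a‖ ^ 2 < 1 := by
    have : 0 < ‖b‖ ^ 2 := by positivity
    linarith
  have hnn := limitDensity_nonneg h0 h1 hab hαβ
  have hint := integrable_limitDensity h0 h1 hab α β
  refine ⟨Eventually.of_forall hnn, hint, integral_limitDensity h0 h1 hab α β, fun x => ?_⟩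
  have hmeas : ∀ t : ℕ, Measurable fun n : ℤ => (n : ℝ) / (3 * (t : ℝ)) := fun t => by fun_prop
  have hprob : ∀ t, IsProbabilityMeasure (rescaledLaw a b c d α β t) := fun t =>
    have := isProbabilityMeasure_positionLaw hU ha hαβ (3 * t)
    Measure.isProbabilityMeasure_map (hmeas t).aemeasurable
  have hlim := isProbabilityMeasure_limitLaw h0 h1 hab hαβ
  let μs : ℕ → ProbabilityMeasure ℝ := fun t => ⟨rescaledLaw a b c d α β t, hprob t⟩
  let μ : ProbabilityMeasure ℝ := ⟨limitLaw a b α β, hlim⟩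
  have hweak : Tendsto μs atTop (𝓝 μ) :=
    ProbabilityMeasure.tendsto_of_tendsto_charFun
      (tendsto_charFun_limitLaw ha hd hb hU hαβ)
  have hcdf := ProbabilityMeasure.tendsto_measure_of_null_frontier_of_tendsto' hweak
    (E := Set.Iic x) (by
      rw [frontier_Iic]
      exact withDensity_absolutelyContinuous _ _ (by simp))
  have hreal := (ENNReal.tendsto_toReal (measure_ne_top (limitLaw a b α β) _)).comp hcdf
  convert hreal using 2
  · rename_i t
    exact (map_measureReal_apply (hmeas t) measurableSet_Iic).symm
  · have : limitLaw a b α β (Set.Iic x) =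
        ENNReal.ofReal (∫ y in Set.Iic x, limitDensity a b α β y) := by
      rw [limitLaw, withDensity_apply _ measurableSet_Iic,
        ofReal_integral_eq_lintegral_ofReal hint.integrableOn (Eventually.of_forall hnn)]
    change _ = (limitLaw a b α β (Set.Iic x)).toReal
    rw [this, ENNReal.toReal_ofReal (integral_nonneg hnn)]
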